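/- Let $\mathcal X$ be a compact (connected) smooth $d$-dimensional Riemannian manifold without boundary, with Riemannian volume $dx$, and let $\mathcal P_2(\mathcal X)$ be the set of probability densities on $\mathcal X$ with respect to $dx$ with finite second moments. Conventions: - For $p\in\mathcal P_2(\mathcal X)$ and $u\in C^2(\mathcal X)$, $-\mathrm{div}(p\nabla u)$ denotes the distribution $\varphi\mapsto\int\langle\nabla u,\nabla\varphi\rangle\,p\,dx$ on $C^2(\mathcal X)$; a function $s\in L^2(dx)$ is identified with the distribution $\varphi\mapsto\int s\varphi\,dx$. The tangent space is $T_p\mathcal P_2(\mathcal X)=\{-\mathrm{div}(p\nabla u): u\in C^2(\mathcal X)\}$ with the Riemannian metric $\langle s_1,s_2\rangle_p=\int\langle\nabla u_1,\nabla u_2\rangle\,p\,dx$, where $s_i=-\mathrm{div}(p\nabla u_i)$. - A curve $t\mapsto\gamma(t)\in\mathcal P_2(\mathcal X)$ with $\gamma(0)=p$ has velocity $s\in L^2(dx)$ at $t=0$ if $(\gamma(t)-p)/t\to s$ in $L^2(dx)$ as $t\downarrow0$. - $F:\mathcal P_2(\mathcal X)\to\mathbb R$ is differentiable at $p$ with functional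 derivative $\delta F/\delta p=g\in L^2(dx)$ (with respect to the $L^2$-structure) if $\frac{d}{dt}F(\gamma(t))|_{t=0^+}=\int g\,s\,dx$ for every curve $\gamma$ through $p$ with velocity $s$. - $G\in T_p\mathcal P_2(\mathcal X)$ is a Wasserstein gradient of $F$ at $p$, $G=\mathrm{grad}\,F(p)$, if $\frac{d}{dt}F(\gamma(t))|_{t=0^+}=\langle G,s\rangle_p$ for every curve $\gamma$ through $p$ with velocity $s\in T_p\mathcal P_2(\mathcal X)$. Let $F:\mathcal P_2(\mathcal X)\to\mathbb R$ and $p\in\mathcal P_2(\mathcal X)$. (i) If $F$ is differentiable at $p$ with a functional derivative $\delta F/\delta p$ of class $C^2$, then $$\mathrm{grad}\,F(p)=-\mathrm{div}\Bigl(p\cdot\nabla\frac{\delta F}{\delta p}\Bigr).$$ If moreover $p$ is of class $C^1$, the right-hand side is the function given by the classical (pointwise) divergence operator of $\mathcal X$; and if in addition $p>0$ everywhere, this is the only Wasserstein gradient of $F$ at $p$. (ii) Let $\mathcal F\subseteq L^2(dx)$ be convex, let $F^*:\mathcal F\to\mathbb R$ be strongly convex with respect to the $L^2(dx)$-norm with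 some modulus $\lambda>0$, and suppose that $$F(q)=\sup_{f\in\mathcal F}\Bigl\{\int f\,q\,dx-F^*(f)\Bigr\}$$ for every $q\in\mathcal P_2(\mathcal X)$ for which these integrals are defined, that they are defined for $q=p$, and that the supremum for $q=p$ is attained at $f_p^*\in\mathcal F$. Then $F$ is differentiable at $p$ and $\delta F/\delta p=f_p^*$: $f_p^*$ is a functional derivative of $F$ at $p$, and every other one equals $f_p^*$ almost everywhere up to an additive constant. Moreover, for every $\phi\in L^2(dx)$ the supremum $\Phi(\varepsilon)=\sup_{f\in\mathcal F}\{\int f\,(p+\varepsilon\phi)\,dx-F^*(f)\}$ is finite for all $\varepsilon\in\mathbb R$, and $\Phi'(0)=\int f_p^*\,\phi\,dx$. Finally, if $f_p^*$ is (almost everywhere equal to) a function of class $C^2$, then $$\mathrm{grad}\,F(p)=-\mathrm{div}(p\,\nabla f_p^*),$$ with the same additions as in (i) when $p$ is $C^1$, respectively $C^1$ and positive. -/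

import Mathlib

open MeasureTheory Filter Topology Set Bundle
open scoped Manifold ContDiff ENNReal

noncomputable section

namespace WassersteinGradient

/-! ### A compact Riemannian manifold: gradient, volume, divergence

`M` is a manifold without boundary, modelled on `ℝ^d`; the Riemannian metric is the inner product
that the `RiemannianBundle` instance puts on each tangent space. -/

section Riemannian

theorem exists_chartCover (d : ℕ) (M : Type*) [TopologicalSpace M]
    [ChartedSpace (EuclideanSpace ℝ (Fin d)) M] [CompactSpace M] :
    ∃ t : Finset M, ∀ z : M, ∃ x ∈ t, z ∈ (chartAt (EuclideanSpace ℝ (Fin d)) x).source := by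
  obtain ⟨t, -, ht⟩ := isCompact_univ.elim_nhds_subcover
    (fun x : M => (chartAt (EuclideanSpace ℝ (Fin d)) x).source)
    (fun x _ => (chartAt (EuclideanSpace ℝ (Fin d)) x).open_source.mem_nhds
      (mem_chart_source _ x))
  exact ⟨t, fun z => by simpa using ht (mem_univ z)⟩

variable {d : ℕ} {M : Type*} [TopologicalSpace M] [ChartedSpace (EuclideanSpace ℝ (Fin d)) M]
  [RiemannianBundle (fun x : M => TangentSpace (𝓡 d) x)]

instance tangentSpace_finiteDimensional (x : M) :
    FiniteDimensional ℝ (TangentSpace (𝓡 d) x) :=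
  inferInstanceAs (FiniteDimensional ℝ (EuclideanSpace ℝ (Fin d)))

instance tangentSpace_completeSpace (x : M) : CompleteSpace (TangentSpace (𝓡 d) x) :=
  FiniteDimensional.complete ℝ _

variable (d) in
/-- The Riemannian gradient `∇u` of a function `u`: the vector that represents the differential
of `u` with respect to the metric, `⟪∇u(x), w⟫ₓ = du(x) w`. -/
def grad (u : M → ℝ) (x : M) : TangentSpace (𝓡 d) x :=
  (InnerProductSpace.toDual ℝ (TangentSpace (𝓡 d) x)).symm (mfderiv (𝓡 d) 𝓘(ℝ, ℝ) u x)

/-- The coordinate vector `∂ᵢ` of the chart at `x₀`, at the point with coordinates `y`. -/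
def coordVector (x₀ : M) (y : EuclideanSpace ℝ (Fin d)) (i : Fin d) :
    TangentSpace (𝓡 d) ((chartAt (EuclideanSpace ℝ (Fin d)) x₀).symm y) :=
  mfderiv (𝓡 d) (𝓡 d) (chartAt (EuclideanSpace ℝ (Fin d)) x₀).symm y
    (EuclideanSpace.single i (1 : ℝ))

/-- `√det (g_ij)` in the chart at `x₀`, where `g_ij = ⟪∂ᵢ, ∂ⱼ⟫`. -/
def sqrtDetMetric (x₀ : M) (y : EuclideanSpace ℝ (Fin d)) : ℝ :=
  Real.sqrt (Matrix.det (Matrix.of fun i j : Fin d =>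
    inner ℝ (coordVector x₀ y i) (coordVector x₀ y j)))

/-- The Riemannian volume on the domain of the chart at `x₀`: the image under the inverse chart of
`√det (g_ij) dy` on the target of the chart. -/
def chartVolume [MeasurableSpace M] (x₀ : M) : Measure M :=
  Measure.map (chartAt (EuclideanSpace ℝ (Fin d)) x₀).symm
    ((volume.restrict (chartAt (EuclideanSpace ℝ (Fin d)) x₀).target).withDensity
      fun y => ENNReal.ofReal (sqrtDetMetric x₀ y))

variable (d M) in
/-- Finitely many points whose charts cover the compact manifold `M`. -/
def chartCover [CompactSpace M] : Finset M := (exists_chartCover d M).choose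

open Classical in
variable (d M) in
/-- The Riemannian volume measure `dx` of `M`. It is glued from the volumes on the chart domains
of a finite cover: at each point, every chart of the cover around that point gets the same weight,
and the weights sum to `1`. (On overlaps the chart volumes agree, by change of variables.) -/
def vol [CompactSpace M] [MeasurableSpace M] : Measure M :=
  ∑ x ∈ chartCover d M, (chartVolume (d := d) x).withDensity fun z =>
    (((chartCover d M).filter fun y =>
      z ∈ (chartAt (EuclideanSpace ℝ (Fin d)) y).source).card : ℝ≥0∞)⁻¹

/-- The divergence of a (continuously differentiable) vector field `V`, at the point `x`: in the
chart at `x`, it is `(1 / √det g) ∑ᵢ ∂ᵢ (√det g · Vⁱ)`, where the `Vⁱ` are the coordinates of `V`. -/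
def divergence (V : ∀ x : M, TangentSpace (𝓡 d) x) (x : M) : ℝ :=
  let c := chartAt (EuclideanSpace ℝ (Fin d)) x
  let coord : EuclideanSpace ℝ (Fin d) → EuclideanSpace ℝ (Fin d) := fun y =>
    mfderiv (𝓡 d) (𝓡 d) c (c.symm y) (V (c.symm y))
  (sqrtDetMetric x (c x))⁻¹ * ∑ i : Fin d,
    fderiv ℝ (fun y => sqrtDetMetric x y * coord y i) (c x) (EuclideanSpace.single i (1 : ℝ))

variable (d M) in
/-- Distributions (of order at most two), i.e. functionals of a test function of class `C²`. -/
abbrev Distrib : Type _ := C^2⟮𝓡 d, M; 𝓘(ℝ, ℝ), ℝ⟯ → ℝ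

/-- A function as a distribution: `φ ↦ ∫ s φ dx`. -/
def ofFun [CompactSpace M] [MeasurableSpace M] (s : M → ℝ) : Distrib d M :=
  fun φ => ∫ x, s x * φ x ∂(vol d M)

/-- The divergence, in the sense of distributions, of an integrable vector field:
`(div V)(φ) = - ∫ ⟪V, ∇φ⟫ dx`. It is defined for fields without any smoothness, such as `p ∇u` with
`p` a probability density. -/
def weakDiv [CompactSpace M] [MeasurableSpace M] (V : ∀ x : M, TangentSpace (𝓡 d) x) :
    Distrib d M :=
  fun φ => - ∫ x, inner ℝ (V x) (grad d φ x) ∂(vol d M)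

end Riemannian

/-! ### The Wasserstein space `𝓟₂(M)` and its Riemannian structure -/

section Wasserstein

variable (d : ℕ) (M : Type*) [MetricSpace M] [ChartedSpace (EuclideanSpace ℝ (Fin d)) M]
  [RiemannianBundle (fun x : M => TangentSpace (𝓡 d) x)] [CompactSpace M] [MeasurableSpace M]

/-- `𝓟₂(M)`: probability densities with respect to the Riemannian volume, with finite second
moments. -/
structure P2 where
  /-- the density -/
  toFun : M → ℝ
  measurable : Measurable toFun
  nonneg : ∀ x, 0 ≤ toFun x
  integrable : Integrable toFun (vol d M)
  integral_eq_one : ∫ x, toFun x ∂(vol d M) = 1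
  second_moment : ∀ x₀ : M, Integrable (fun x => dist x x₀ ^ 2 * toFun x) (vol d M)

instance : CoeFun (P2 d M) (fun _ => M → ℝ) := ⟨P2.toFun⟩

variable {d M}

/-- The distribution `-div (p ∇u)`. -/
def negDiv (p : P2 d M) (u : M → ℝ) : Distrib d M :=
  - weakDiv fun x => p x • grad d u x

/-- The tangent space `T_p 𝓟₂(M)`: the `s` for which the elliptic equation `-div (p ∇u) = s` has a
twice continuously differentiable solution `u`. -/
def tangentSet (p : P2 d M) : Set (Distrib d M) :=
  {S | ∃ u : C^2⟮𝓡 d, M; 𝓘(ℝ, ℝ), ℝ⟯, negDiv p u = S}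

open Classical in
/-- A solution `u` of `-div (p ∇u) = S` (the zero function if there is none). -/
def potential (p : P2 d M) (S : Distrib d M) : C^2⟮𝓡 d, M; 𝓘(ℝ, ℝ), ℝ⟯ :=
  if h : S ∈ tangentSet p then h.choose else 0

/-- The Riemannian metric of `𝓟₂(M)` at `p`: `⟨S₁, S₂⟩_p = ∫ ⟪∇u₁, ∇u₂⟫ p dx`, where `uᵢ` solves
`-div (p ∇uᵢ) = Sᵢ`. -/
def wInner (p : P2 d M) (S₁ S₂ : Distrib d M) : ℝ :=
  ∫ x, inner ℝ (grad d (potential p S₁) x) (grad d (potential p S₂) x) * p x ∂(vol d M)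

theorem negDiv_apply (p : P2 d M) (u : M → ℝ) (φ : C^2⟮𝓡 d, M; 𝓘(ℝ, ℝ), ℝ⟯) :
    negDiv p u φ = ∫ x, inner ℝ (grad d u x) (grad d φ x) * p x ∂(vol d M) := by
  simp only [negDiv, weakDiv, Pi.neg_apply, neg_neg]
  refine integral_congr_ae (Eventually.of_forall fun x => ?_)
  simp only [inner_smul_left, RCLike.conj_to_real]
  ring

/-- The metric does not depend on the choice of the solutions. -/
theorem wInner_negDiv (p : P2 d M) (u v : C^2⟮𝓡 d, M; 𝓘(ℝ, ℝ), ℝ⟯) :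
    wInner p (negDiv p u) (negDiv p v)
      = ∫ x, inner ℝ (grad d u x) (grad d v x) * p x ∂(vol d M) := by
  have key : ∀ w : C^2⟮𝓡 d, M; 𝓘(ℝ, ℝ), ℝ⟯,
      negDiv p (potential p (negDiv p w)) = negDiv p w := by
    intro w
    have h : negDiv p w ∈ tangentSet p := ⟨w, rfl⟩
    rw [potential, dif_pos h]
    exact h.choose_spec
  have h1 : wInner p (negDiv p u) (negDiv p v)
      = negDiv p u (potential p (negDiv p v)) := by
    rw [← key u, negDiv_apply, key u]
    rfl
  have h2 : negDiv p u (potential p (negDiv p v)) = negDiv p v u := by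
    rw [← key v, negDiv_apply p (potential p (negDiv p v)), negDiv_apply, key v]
    simp only [real_inner_comm]
  rw [h1, h2, negDiv_apply]
  simp only [real_inner_comm]

/-- `γ` is a curve in `𝓟₂(M)` that starts at `p` with velocity `∂γ/∂t = s` at `t = 0`: the
difference quotients `(γ(t) - p) / t` converge to `s` in `L²(dx)` as `t ↓ 0`. -/
def HasVelocity (γ : ℝ → P2 d M) (p : P2 d M) (s : M → ℝ) : Prop :=
  γ 0 = p ∧ MemLp s 2 (vol d M) ∧
    Tendsto (fun t : ℝ => eLpNorm (fun x => (γ t x - p x) / t - s x) 2 (vol d M))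
      (𝓝[>] 0) (𝓝 0)

/-- `g` is the functional derivative `δF/δp` of `F` at `p`, that is, the gradient with respect to
the `L²` inner product: along every curve through `p` with velocity `s`, the derivative of `F` is
`∫ g s dx`. (As velocities have mean zero, `g` matters only up to additive constants.) -/
def IsFunctionalDerivative (F : P2 d M → ℝ) (p : P2 d M) (g : M → ℝ) : Prop :=
  MemLp g 2 (vol d M) ∧ ∀ (γ : ℝ → P2 d M) (s : M → ℝ), HasVelocity γ p s →
    HasDerivWithinAt (fun t => F (γ t)) (∫ x, g x * s x ∂(vol d M)) (Ici 0) 0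

/-- `G` is the Wasserstein gradient of `F` at `p`, that is, the gradient with respect to the
Riemannian metric of `𝓟₂(M)`: it is a tangent vector, and along every curve through `p` with
velocity `S` in the tangent space, the derivative of `F` is `⟨G, S⟩_p`. -/
def IsWassersteinGradient (F : P2 d M → ℝ) (p : P2 d M) (G : Distrib d M) : Prop :=
  G ∈ tangentSet p ∧ ∀ S ∈ tangentSet p, ∀ (γ : ℝ → P2 d M) (s : M → ℝ),
    HasVelocity γ p s → ofFun s = S →
      HasDerivWithinAt (fun t => F (γ t)) (wInner p G S) (Ici 0) 0

end Wasserstein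

end WassersteinGradient

end

/-! Part (i) rests on one observation: a `C²` functional derivative `g` is itself a test function.
If a velocity `s` equals `-div (p ∇u)` as a distribution, testing with `g` gives `∫ g s = ∫ ⟪∇u, ∇g⟫
p`, which is the Wasserstein inner product of `-div (p ∇g)` and `-div (p ∇u)`
(`IsFunctionalDerivative.isWassersteinGradient`). This needs no smoothness of `p`.

When `p` is `C¹`, the field `p ∇g` is `C¹`, and the divergence theorem turns the distribution into a
function. Most of the geometry serves this theorem: the glued volume has density `√det g` in every
chart (`vol_restrict_source`), integration by parts in one chart is the Euclidean one applied to
`√det g · Vⁱ φ`, the local divergences agree on overlaps, and a partition of unity globalizes.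

If moreover `p > 0`, every tangent vector is the velocity of some curve `p + t s`. Two gradients
with potentials `v` and `g` then have the same inner product with the tangent vector of potential `w
= v - g`, so `∫ |∇w|² p = 0` and the two distributions coincide.

Part (ii) is a quantitative envelope theorem. The function `f ↦ F*(f) - ∫ f p` is `λ`-strongly
convex with minimizer `f_p`, so it grows at least like `(λ/2) ‖f - f_p‖²`. Replacing `p` by `p + η`
favours `f` over `f_p` by at most `‖f - f_p‖ ‖η‖`. Maximizing the difference of the two bounds gives
`0 ≤ F(p + η) - F(p) - ∫ f_p η ≤ ‖η‖² / (2λ)` (`abs_sub_le_of_isLUB`), hence differentiability along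
lines and along curves. Uniqueness up to constants follows by testing with velocities that move mass
from a set where `p` is bounded below to an arbitrary set. -/

noncomputable section

namespace WassersteinGradient

/-! ### The metric in coordinates -/

section Coordinates

variable {d : ℕ} {M : Type*} [TopologicalSpace M] [ChartedSpace (EuclideanSpace ℝ (Fin d)) M]

/-- The differential of the chart at `x`, at the point `z`. -/
def chartDeriv (x z : M) : EuclideanSpace ℝ (Fin d) →L[ℝ] EuclideanSpace ℝ (Fin d) :=
  mfderiv (𝓡 d) (𝓡 d) (chartAt (EuclideanSpace ℝ (Fin d)) x) z

/-- The differential of the inverse of the chart at `x`, at the point with coordinates `y`. -/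
def chartSymmDeriv (x : M) (y : EuclideanSpace ℝ (Fin d)) :
    EuclideanSpace ℝ (Fin d) →L[ℝ] EuclideanSpace ℝ (Fin d) :=
  mfderiv (𝓡 d) (𝓡 d) (chartAt (EuclideanSpace ℝ (Fin d)) x).symm y

/-- The change of coordinates from the chart at `x` to the chart at `x'`. -/
def transition (x x' : M) (y : EuclideanSpace ℝ (Fin d)) : EuclideanSpace ℝ (Fin d) :=
  chartAt (EuclideanSpace ℝ (Fin d)) x' ((chartAt (EuclideanSpace ℝ (Fin d)) x).symm y)

theorem chartDeriv_chartSymmDeriv [IsManifold (𝓡 d) ∞ M] {x z : M}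
    (hz : z ∈ (chartAt (EuclideanSpace ℝ (Fin d)) x).source) (u : EuclideanSpace ℝ (Fin d)) :
    chartDeriv x z (chartSymmDeriv x (chartAt (EuclideanSpace ℝ (Fin d)) x z) u) = u := by
  have h := (mdifferentiable_chart (I := 𝓡 d) x).comp_symm_deriv
    ((chartAt (EuclideanSpace ℝ (Fin d)) x).map_source hz)
  rw [(chartAt (EuclideanSpace ℝ (Fin d)) x).left_inv hz] at h
  exact DFunLike.congr_fun h u

theorem chartSymmDeriv_chartDeriv [IsManifold (𝓡 d) ∞ M] {x z : M}
    (hz : z ∈ (chartAt (EuclideanSpace ℝ (Fin d)) x).source) (u : EuclideanSpace ℝ (Fin d)) :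
    chartSymmDeriv x (chartAt (EuclideanSpace ℝ (Fin d)) x z) (chartDeriv x z u) = u :=
  DFunLike.congr_fun ((mdifferentiable_chart (I := 𝓡 d) x).symm_comp_deriv hz) u

theorem hasFDerivAt_transition [IsManifold (𝓡 d) ∞ M] {x x' : M}
    {y : EuclideanSpace ℝ (Fin d)} (hy : y ∈ (chartAt (EuclideanSpace ℝ (Fin d)) x).target)
    (hy' : (chartAt (EuclideanSpace ℝ (Fin d)) x).symm y
      ∈ (chartAt (EuclideanSpace ℝ (Fin d)) x').source) :
    HasFDerivAt (transition x x')
      ((chartDeriv x' ((chartAt (EuclideanSpace ℝ (Fin d)) x).symm y)).comp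
        (chartSymmDeriv x y)) y := by
  have h1 := ((mdifferentiable_chart (I := 𝓡 d) x).mdifferentiableAt_symm hy).hasMFDerivAt
  have h2 := ((mdifferentiable_chart (I := 𝓡 d) x').mdifferentiableAt hy').hasMFDerivAt
  exact (h2.comp y h1).hasFDerivAt

theorem chartSymmDeriv_transition [IsManifold (𝓡 d) ∞ M] {x x' : M}
    {y : EuclideanSpace ℝ (Fin d)}
    (hy' : (chartAt (EuclideanSpace ℝ (Fin d)) x).symm y
      ∈ (chartAt (EuclideanSpace ℝ (Fin d)) x').source) (u : EuclideanSpace ℝ (Fin d)) :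
    chartSymmDeriv x' (transition x x' y)
      ((chartDeriv x' ((chartAt (EuclideanSpace ℝ (Fin d)) x).symm y)).comp
        (chartSymmDeriv x y) u) = chartSymmDeriv x y u :=
  chartSymmDeriv_chartDeriv hy' _

/-- The coordinate vectors of a chart are linearly independent. -/
theorem linearIndependent_chartSymmDeriv [IsManifold (𝓡 d) ∞ M] {x z : M}
    (hz : z ∈ (chartAt (EuclideanSpace ℝ (Fin d)) x).source) :
    LinearIndependent ℝ fun i : Fin d =>
      chartSymmDeriv x (chartAt (EuclideanSpace ℝ (Fin d)) x z)
        (EuclideanSpace.single i (1 : ℝ)) := by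
  have h := (EuclideanSpace.basisFun (Fin d) ℝ).toBasis.linearIndependent
  have hinj : Function.Injective
      (chartSymmDeriv x (chartAt (EuclideanSpace ℝ (Fin d)) x z)).toLinearMap :=
    Function.LeftInverse.injective (g := chartDeriv x z) (chartDeriv_chartSymmDeriv hz)
  have h2 := h.map' _ (LinearMap.ker_eq_bot.2 hinj)
  simpa [Function.comp_def] using h2

variable [RiemannianBundle (fun x : M => TangentSpace (𝓡 d) x)]

/-- The metric at `z`, as a bilinear function on the model space. -/
def metricAt (z : M) (u v : EuclideanSpace ℝ (Fin d)) : ℝ :=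
  inner ℝ (show TangentSpace (𝓡 d) z from u) (show TangentSpace (𝓡 d) z from v)

theorem metricAt_sum_left {ι : Type*} (s : Finset ι) (z : M) (a : ι → ℝ)
    (u : ι → EuclideanSpace ℝ (Fin d)) (v : EuclideanSpace ℝ (Fin d)) :
    metricAt z (∑ i ∈ s, a i • u i) v = ∑ i ∈ s, a i * metricAt z (u i) v := by
  have h := sum_inner (𝕜 := ℝ) (E := TangentSpace (𝓡 d) z) s (fun i => a i • (u i)) v
  refine Eq.trans h (Finset.sum_congr rfl fun i _ => ?_)
  exact real_inner_smul_left (F := TangentSpace (𝓡 d) z) _ _ _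

theorem metricAt_sum_right {ι : Type*} (s : Finset ι) (z : M) (a : ι → ℝ)
    (u : ι → EuclideanSpace ℝ (Fin d)) (v : EuclideanSpace ℝ (Fin d)) :
    metricAt z v (∑ i ∈ s, a i • u i) = ∑ i ∈ s, a i * metricAt z v (u i) := by
  have h := inner_sum (𝕜 := ℝ) (E := TangentSpace (𝓡 d) z) s (fun i => a i • (u i)) v
  refine Eq.trans h (Finset.sum_congr rfl fun i _ => ?_)
  exact real_inner_smul_right (F := TangentSpace (𝓡 d) z) _ _ _

/-- The matrix `(g_ij)` of the metric in the chart at `x`. -/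
def metricMatrix (x : M) (y : EuclideanSpace ℝ (Fin d)) : Matrix (Fin d) (Fin d) ℝ :=
  Matrix.of fun i j => metricAt ((chartAt (EuclideanSpace ℝ (Fin d)) x).symm y)
    (chartSymmDeriv x y (EuclideanSpace.single i (1 : ℝ)))
    (chartSymmDeriv x y (EuclideanSpace.single j (1 : ℝ)))

theorem sqrtDetMetric_eq (x : M) (y : EuclideanSpace ℝ (Fin d)) :
    sqrtDetMetric x y = √(metricMatrix x y).det := rfl

theorem metricMatrix_posDef [IsManifold (𝓡 d) ∞ M] {x : M} {y : EuclideanSpace ℝ (Fin d)}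
    (hy : y ∈ (chartAt (EuclideanSpace ℝ (Fin d)) x).target) : (metricMatrix x y).PosDef := by
  have hz := (chartAt (EuclideanSpace ℝ (Fin d)) x).map_target hy
  have h := linearIndependent_chartSymmDeriv hz
  rw [(chartAt (EuclideanSpace ℝ (Fin d)) x).right_inv hy] at h
  exact Matrix.posDef_gram_of_linearIndependent (𝕜 := ℝ)
    (E := TangentSpace (𝓡 d) ((chartAt (EuclideanSpace ℝ (Fin d)) x).symm y)) h

theorem sqrtDetMetric_pos [IsManifold (𝓡 d) ∞ M] {x : M} {y : EuclideanSpace ℝ (Fin d)}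
    (hy : y ∈ (chartAt (EuclideanSpace ℝ (Fin d)) x).target) : 0 < sqrtDetMetric x y :=
  Real.sqrt_pos.2 (metricMatrix_posDef hy).det_pos

/-- With `J` the Jacobian matrix of the transition, the Gram matrices satisfy `g = Jᵀ g' J`; the
determinant picks up `(det J)²`, and the root gives `|det J|`. -/
theorem sqrtDetMetric_transition [IsManifold (𝓡 d) ∞ M] {x x' : M}
    {y : EuclideanSpace ℝ (Fin d)} (hy : y ∈ (chartAt (EuclideanSpace ℝ (Fin d)) x).target)
    (hy' : (chartAt (EuclideanSpace ℝ (Fin d)) x).symm y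
      ∈ (chartAt (EuclideanSpace ℝ (Fin d)) x').source) :
    sqrtDetMetric x y = |(fderiv ℝ (transition x x') y).det|
      * sqrtDetMetric x' (transition x x' y) := by
  set L := (chartDeriv x' ((chartAt (EuclideanSpace ℝ (Fin d)) x).symm y)).comp
        (chartSymmDeriv x y) with hL
  rw [(hasFDerivAt_transition hy hy').fderiv, ← hL]
  set b := (EuclideanSpace.basisFun (Fin d) ℝ).toBasis with hb
  set J := LinearMap.toMatrix b b L.toLinearMap with hJ
  have hdet : L.det = J.det := (LinearMap.det_toMatrix b L.toLinearMap).symm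
  have hz : (chartAt (EuclideanSpace ℝ (Fin d)) x').symm (transition x x' y)
      = (chartAt (EuclideanSpace ℝ (Fin d)) x).symm y :=
    (chartAt (EuclideanSpace ℝ (Fin d)) x').left_inv hy'
  have hexp : ∀ i, chartSymmDeriv x y (EuclideanSpace.single i (1 : ℝ))
      = ∑ k, J k i • chartSymmDeriv x' (transition x x' y) (EuclideanSpace.single k (1 : ℝ)) := by
    intro i
    rw [← chartSymmDeriv_transition hy', ← hL]
    have : L (EuclideanSpace.single i (1 : ℝ)) = ∑ k, J k i • EuclideanSpace.single k (1 : ℝ) := by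
      have h1 := b.sum_repr (L (EuclideanSpace.single i (1 : ℝ)))
      rw [← h1]
      refine Finset.sum_congr rfl fun k _ => ?_
      simp [hJ, hb, LinearMap.toMatrix_apply]
    rw [this]
    simp
  have hmat : metricMatrix x y = J.transpose * metricMatrix x' (transition x x' y) * J := by
    ext i j
    simp only [metricMatrix, Matrix.of_apply, hz, Matrix.mul_apply, Matrix.transpose_apply]
    rw [hexp i, hexp j, metricAt_sum_right]
    refine Finset.sum_congr rfl fun k _ => ?_
    rw [metricAt_sum_left, mul_comm]
  rw [sqrtDetMetric_eq, sqrtDetMetric_eq, hmat, Matrix.det_mul, Matrix.det_mul,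
    Matrix.det_transpose, hdet, show J.det * (metricMatrix x' (transition x x' y)).det * J.det
      = J.det ^ 2 * (metricMatrix x' (transition x x' y)).det by ring,
    Real.sqrt_mul (sq_nonneg _), Real.sqrt_sq_eq_abs]

/-- The entries are metric pairings of the coordinate vector fields, and each of these is the
tangent map of the inverse chart applied to a constant field. -/
theorem contDiffOn_metricMatrix [IsManifold (𝓡 d) ∞ M]
    [IsContMDiffRiemannianBundle (𝓡 d) ∞ (EuclideanSpace ℝ (Fin d))
      (fun x : M => TangentSpace (𝓡 d) x)] (x : M) (i j : Fin d) :
    ContDiffOn ℝ 1 (fun y => metricMatrix x y i j)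
      (chartAt (EuclideanSpace ℝ (Fin d)) x).target := by
  have key : ∀ i : Fin d, ContMDiffOn (𝓡 d) ((𝓡 d).prod 𝓘(ℝ, EuclideanSpace ℝ (Fin d))) 1
      (fun y : EuclideanSpace ℝ (Fin d) =>
        (⟨(chartAt (EuclideanSpace ℝ (Fin d)) x).symm y,
          chartSymmDeriv x y (EuclideanSpace.single i (1 : ℝ))⟩ :
          TotalSpace (EuclideanSpace ℝ (Fin d)) (fun z : M => TangentSpace (𝓡 d) z)))
      (chartAt (EuclideanSpace ℝ (Fin d)) x).target := by
    intro i
    -- The tangent map costs one derivative, so a `C²` inverse chart yields `C¹` coordinate fields.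
    have h := contMDiffOn_chart_symm (I := 𝓡 d) (n := 2) (x := x)
    have ho := (chartAt (EuclideanSpace ℝ (Fin d)) x).open_target
    have h2 := h.contMDiffOn_tangentMapWithin (m := 1) (by norm_num) ho.uniqueMDiffOn
    have h3 : ContMDiffOn (𝓡 d) (𝓡 d).tangent 1
        (fun y => (⟨y, EuclideanSpace.single i (1 : ℝ)⟩ :
          TangentBundle (𝓡 d) (EuclideanSpace ℝ (Fin d))))
        (chartAt (EuclideanSpace ℝ (Fin d)) x).target :=
      contMDiffOn_vectorSpace_iff_contDiffOn.2 contDiffOn_const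
    refine (h2.comp h3 fun y hy => hy).congr fun y hy => ?_
    simp only [Function.comp_apply, tangentMapWithin]
    rw [mfderivWithin_of_isOpen ho hy]
    rfl
  have : IsContMDiffRiemannianBundle (𝓡 d) 1 (EuclideanSpace ℝ (Fin d))
      (fun x : M => TangentSpace (𝓡 d) x) :=
    IsContMDiffRiemannianBundle.of_le (n := ∞) (by norm_cast)
  exact (ContMDiffOn.inner_bundle (E := fun x : M => TangentSpace (𝓡 d) x)
    (key i) (key j)).contDiffOn

theorem contDiffOn_det_of_entries {n : ℕ} {V : Type*} [NormedAddCommGroup V] [NormedSpace ℝ V]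
    {k : WithTop ℕ∞} {s : Set V} {A : V → Matrix (Fin n) (Fin n) ℝ}
    (hA : ∀ i j, ContDiffOn ℝ k (fun y => A y i j) s) :
    ContDiffOn ℝ k (fun y => (A y).det) s := by
  simp only [Matrix.det_apply']
  exact ContDiffOn.sum fun σ _ => contDiffOn_const.mul (contDiffOn_prod fun i _ => hA _ _)

theorem contDiffOn_sqrtDetMetric [IsManifold (𝓡 d) ∞ M]
    [IsContMDiffRiemannianBundle (𝓡 d) ∞ (EuclideanSpace ℝ (Fin d))
      (fun x : M => TangentSpace (𝓡 d) x)] (x : M) :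
    ContDiffOn ℝ 1 (fun y => sqrtDetMetric (d := d) x y)
      (chartAt (EuclideanSpace ℝ (Fin d)) x).target :=
  (contDiffOn_det_of_entries (contDiffOn_metricMatrix x)).sqrt
    fun _ hy => (metricMatrix_posDef hy).det_pos.ne'

/-- Cramer's rule: the inverse is the adjugate, polynomial in the entries, divided by the
determinant. -/
theorem contDiffOn_inv_mulVec {n : ℕ} {V : Type*} [NormedAddCommGroup V] [NormedSpace ℝ V]
    {k : WithTop ℕ∞} {s : Set V} {A : V → Matrix (Fin n) (Fin n) ℝ} {v : V → Fin n → ℝ}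
    (hA : ∀ i j, ContDiffOn ℝ k (fun y => A y i j) s) (hdet : ∀ y ∈ s, (A y).det ≠ 0)
    (hv : ∀ i, ContDiffOn ℝ k (fun y => v y i) s) (i : Fin n) :
    ContDiffOn ℝ k (fun y => ((A y)⁻¹.mulVec (v y)) i) s := by
  have hadj : ∀ j, ContDiffOn ℝ k (fun y => (A y).adjugate i j) s := by
    intro j
    simp only [Matrix.adjugate_apply]
    refine contDiffOn_det_of_entries fun a b => ?_
    by_cases h : a = j
    · simp only [h, Matrix.updateRow_self]
      exact contDiffOn_const
    · simpa only [Matrix.updateRow_ne h] using hA a b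
  have h : ∀ y, ((A y)⁻¹.mulVec (v y)) i
      = ((A y).det)⁻¹ * ∑ j, (A y).adjugate i j * v y j := fun y => by
    simp [Matrix.inv_def, Matrix.mulVec, dotProduct, Finset.mul_sum, mul_assoc]
  simp only [h]
  exact ((contDiffOn_det_of_entries hA).inv hdet).mul
    (ContDiffOn.sum fun j _ => (hadj j).mul (hv j))

end Coordinates

/-! ### The Riemannian volume in charts -/

section Volume

variable {d : ℕ} {M : Type*} [TopologicalSpace M] [ChartedSpace (EuclideanSpace ℝ (Fin d)) M]
  [MeasurableSpace M]

theorem aemeasurable_chart_symm [BorelSpace M] (x : M) (ρ : EuclideanSpace ℝ (Fin d) → ℝ≥0∞) :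
    AEMeasurable (chartAt (EuclideanSpace ℝ (Fin d)) x).symm
      ((volume.restrict (chartAt (EuclideanSpace ℝ (Fin d)) x).target).withDensity ρ) :=
  ((chartAt (EuclideanSpace ℝ (Fin d)) x).continuousOn_symm.aemeasurable
    (chartAt (EuclideanSpace ℝ (Fin d)) x).open_target.measurableSet).mono_ac
    (withDensity_absolutelyContinuous _ _)

variable [RiemannianBundle (fun x : M => TangentSpace (𝓡 d) x)]

theorem chartVolume_apply [BorelSpace M] (x : M) {A : Set M} (hA : MeasurableSet A) :
    chartVolume (d := d) x A = ∫⁻ y in (chartAt (EuclideanSpace ℝ (Fin d)) x).target ∩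
      (chartAt (EuclideanSpace ℝ (Fin d)) x).symm ⁻¹' A, ENNReal.ofReal (sqrtDetMetric x y) := by
  rw [chartVolume, Measure.map_apply_of_aemeasurable (aemeasurable_chart_symm x _) hA,
    withDensity_apply',
    Measure.restrict_restrict' (chartAt (EuclideanSpace ℝ (Fin d)) x).open_target.measurableSet,
    inter_comm]

theorem chartVolume_restrict_source [BorelSpace M] (x : M) :
    (chartVolume (d := d) x).restrict (chartAt (EuclideanSpace ℝ (Fin d)) x).source
      = chartVolume (d := d) x := by
  ext A hA
  have hS := (chartAt (EuclideanSpace ℝ (Fin d)) x).open_source.measurableSet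
  rw [Measure.restrict_apply hA, chartVolume_apply x (hA.inter hS), chartVolume_apply x hA]
  congr 2
  ext y
  simp only [mem_inter_iff, mem_preimage]
  exact ⟨fun h => ⟨h.1, h.2.1⟩, fun h =>
    ⟨h.1, h.2, (chartAt (EuclideanSpace ℝ (Fin d)) x).map_target h.1⟩⟩

/-- The volumes of two charts agree on the overlap of their domains. -/
theorem chartVolume_restrict_inter [BorelSpace M] [IsManifold (𝓡 d) ∞ M] (x x' : M) :
    (chartVolume (d := d) x).restrict ((chartAt (EuclideanSpace ℝ (Fin d)) x).source ∩
        (chartAt (EuclideanSpace ℝ (Fin d)) x').source)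
      = (chartVolume (d := d) x').restrict ((chartAt (EuclideanSpace ℝ (Fin d)) x).source ∩
        (chartAt (EuclideanSpace ℝ (Fin d)) x').source) := by
  set c := chartAt (EuclideanSpace ℝ (Fin d)) x with hc
  set c' := chartAt (EuclideanSpace ℝ (Fin d)) x' with hc'
  ext A hA
  have hA' : MeasurableSet (A ∩ (c.source ∩ c'.source)) :=
    hA.inter (c.open_source.measurableSet.inter c'.open_source.measurableSet)
  rw [Measure.restrict_apply hA, Measure.restrict_apply hA, chartVolume_apply x hA',
    chartVolume_apply x' hA']
  set B := A ∩ (c.source ∩ c'.source) with hB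
  have hmeas : MeasurableSet (c.target ∩ c.symm ⁻¹' B) := by
    -- The inverse chart is continuous only on the target, so measurability is checked in the
    -- subtype and transported back.
    have h1 := (continuousOn_iff_continuous_domRestrict.1 c.continuousOn_symm).measurable hA'
    have h2 := c.open_target.measurableSet.subtype_image h1
    convert h2 using 1
    ext y
    simp [and_comm]
  have himg : transition x x' '' (c.target ∩ c.symm ⁻¹' B) = c'.target ∩ c'.symm ⁻¹' B := by
    ext w
    constructor
    · rintro ⟨y, ⟨hy, hyB⟩, rfl⟩
      refine ⟨c'.map_source hyB.2.2, ?_⟩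
      change c'.symm (c' (c.symm y)) ∈ B
      rwa [c'.left_inv hyB.2.2]
    · rintro ⟨hw, hwB⟩
      refine ⟨c (c'.symm w), ⟨c.map_source hwB.2.1, ?_⟩, ?_⟩
      · change c.symm (c (c'.symm w)) ∈ B
        rwa [c.left_inv hwB.2.1]
      · change c' (c.symm (c (c'.symm w))) = w
        rw [c.left_inv hwB.2.1, c'.right_inv hw]
  have hinj : InjOn (transition x x') (c.target ∩ c.symm ⁻¹' B) := by
    intro y hy w hw h
    exact c.symm.injOn hy.1 hw.1 (c'.injOn hy.2.2.2 hw.2.2.2 h)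
  -- Change of variables along the transition map; its Jacobian factor is the one relating the two
  -- densities.
  rw [← hc', ← himg, lintegral_image_eq_lintegral_abs_det_fderiv_mul volume hmeas
    (fun y hy => ((hasFDerivAt_transition hy.1 hy.2.2.2).differentiableAt.hasFDerivAt
      ).hasFDerivWithinAt) hinj]
  refine setLIntegral_congr_fun hmeas fun y hy => ?_
  rw [sqrtDetMetric_transition hy.1 hy.2.2.2, ENNReal.ofReal_mul (abs_nonneg _)]

/-- On the domain of `x₀` every chart volume of the cover can be replaced by that of `x₀`. The
weights `1 / N`, summed over the `N` charts around a point, then give `1`. -/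
theorem vol_restrict_source [BorelSpace M] [IsManifold (𝓡 d) ∞ M] [CompactSpace M] (x₀ : M) :
    (vol d M).restrict (chartAt (EuclideanSpace ℝ (Fin d)) x₀).source
      = chartVolume (d := d) x₀ := by
  classical
  set S : M → Set M := fun x => (chartAt (EuclideanSpace ℝ (Fin d)) x).source with hS
  have hSm : ∀ x, MeasurableSet (S x) :=
    fun x => (chartAt (EuclideanSpace ℝ (Fin d)) x).open_source.measurableSet
  set N : M → ℝ≥0∞ := fun z => (((chartCover d M).filter fun y => z ∈ S y).card : ℝ≥0∞) with hN
  have hNsum : ∀ z, N z = ∑ x ∈ chartCover d M, (S x).indicator (fun _ => (1 : ℝ≥0∞)) z := by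
    intro z
    simp only [hN, indicator_apply, Finset.sum_boole]
  have hNm : Measurable N := by
    simp only [funext hNsum]
    exact Finset.measurable_fun_sum _ fun x _ => measurable_const.indicator (hSm x)
  -- The charts cover `M`, so the weight `1 / N` is never `1 / 0`.
  have hN0 : ∀ z, N z ≠ 0 := by
    intro z
    obtain ⟨x, hx, hz⟩ := (exists_chartCover d M).choose_spec z
    simp only [hN, ne_eq, Nat.cast_eq_zero, Finset.card_eq_zero]
    exact Finset.ne_empty_of_mem (Finset.mem_filter.2 ⟨hx, hz⟩)
  have hNtop : ∀ z, N z ≠ ⊤ := fun z => ENNReal.natCast_ne_top _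
  ext A hA
  rw [Measure.restrict_apply hA, ← chartVolume_restrict_source x₀, Measure.restrict_apply hA]
  have hA' : MeasurableSet (A ∩ S x₀) := hA.inter (hSm x₀)
  have hterm : ∀ x ∈ chartCover d M, ((chartVolume (d := d) x).withDensity fun z => (N z)⁻¹)
      (A ∩ S x₀) = ∫⁻ z in A ∩ S x₀, (S x).indicator (fun z => (N z)⁻¹) z
        ∂(chartVolume (d := d) x₀) := by
    intro x _
    rw [withDensity_apply _ hA', ← chartVolume_restrict_source x,
      Measure.restrict_restrict hA', lintegral_indicator (hSm x), Measure.restrict_restrict (hSm x)]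
    have h := congrArg (fun μ => μ.restrict A) (chartVolume_restrict_inter (d := d) x x₀)
    simp only [Measure.restrict_restrict hA] at h
    have e1 : A ∩ S x₀ ∩ S x = A ∩ (S x ∩ S x₀) := by grind
    have e2 : S x ∩ (A ∩ S x₀) = A ∩ (S x ∩ S x₀) := by grind
    change ∫⁻ z in A ∩ S x₀ ∩ S x, _ ∂_ = _
    rw [e1, e2]
    exact congrArg (fun μ => ∫⁻ z, (N z)⁻¹ ∂μ) h
  have hvol : vol d M (A ∩ S x₀)
      = ∑ x ∈ chartCover d M, ((chartVolume (d := d) x).withDensity fun z => (N z)⁻¹)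
        (A ∩ S x₀) := by
    rw [vol, Measure.finsetSum_apply]
  change vol d M (A ∩ S x₀) = chartVolume (d := d) x₀ (A ∩ S x₀)
  rw [hvol, Finset.sum_congr rfl hterm,
    ← lintegral_finsetSum (f := fun x z => (S x).indicator (fun z => (N z)⁻¹) z) _
      fun x _ => hNm.inv.indicator (hSm x)]
  have : ∀ z, ∑ x ∈ chartCover d M, (S x).indicator (fun z => (N z)⁻¹) z = 1 := by
    intro z
    have e : ∀ x, (S x).indicator (fun z => (N z)⁻¹) z
        = (S x).indicator (fun _ => (1 : ℝ≥0∞)) z * (N z)⁻¹ := by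
      intro x
      by_cases h : z ∈ S x <;> simp [h]
    rw [Finset.sum_congr rfl fun x _ => e x, ← Finset.sum_mul, ← hNsum,
      ENNReal.mul_inv_cancel (hN0 z) (hNtop z)]
  simp [this]

theorem vol_apply_of_subset_source [BorelSpace M] [IsManifold (𝓡 d) ∞ M] [CompactSpace M]
    {x₀ : M} {A : Set M} (hA : MeasurableSet A)
    (h : A ⊆ (chartAt (EuclideanSpace ℝ (Fin d)) x₀).source) :
    vol d M A = ∫⁻ y in (chartAt (EuclideanSpace ℝ (Fin d)) x₀).target ∩
      (chartAt (EuclideanSpace ℝ (Fin d)) x₀).symm ⁻¹' A,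
        ENNReal.ofReal (sqrtDetMetric x₀ y) := by
  rw [← chartVolume_apply x₀ hA, ← vol_restrict_source x₀, Measure.restrict_apply hA,
    inter_eq_left.2 h]

variable [BorelSpace M] [IsManifold (𝓡 d) ∞ M] [CompactSpace M]
  [IsContMDiffRiemannianBundle (𝓡 d) ∞ (EuclideanSpace ℝ (Fin d))
      (fun x : M => TangentSpace (𝓡 d) x)]

/-- An integral over the domain of a chart, in coordinates. -/
theorem integral_vol_eq_integral_target {x₀ : M} {f : M → ℝ} (hf : Measurable f)
    (h : ∀ z, z ∉ (chartAt (EuclideanSpace ℝ (Fin d)) x₀).source → f z = 0) :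
    ∫ z, f z ∂(vol d M) = ∫ y in (chartAt (EuclideanSpace ℝ (Fin d)) x₀).target,
      sqrtDetMetric x₀ y * f ((chartAt (EuclideanSpace ℝ (Fin d)) x₀).symm y) := by
  have hT := (chartAt (EuclideanSpace ℝ (Fin d)) x₀).open_target.measurableSet
  rw [← setIntegral_eq_integral_of_forall_compl_eq_zero h, vol_restrict_source, chartVolume,
    integral_map (aemeasurable_chart_symm x₀ _) hf.aestronglyMeasurable,
    integral_withDensity_eq_integral_toReal_smul₀
      ((contDiffOn_sqrtDetMetric x₀).continuousOn.aemeasurable hT).ennreal_ofReal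
      (Eventually.of_forall fun _ => ENNReal.ofReal_lt_top)]
  refine integral_congr_ae (Eventually.of_forall fun y => ?_)
  simp only [smul_eq_mul, sqrtDetMetric, ENNReal.toReal_ofReal (Real.sqrt_nonneg _)]

/-- The continuous density is integrable on a closed coordinate ball, so the volume is locally
finite; compactness does the rest. -/
instance isFiniteMeasure_vol : IsFiniteMeasure (vol d M) := by
  have : IsLocallyFiniteMeasure (vol d M) := by
    refine ⟨fun z => ?_⟩
    set c := chartAt (EuclideanSpace ℝ (Fin d)) z with hc
    have hz : z ∈ c.source := mem_chart_source _ z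
    obtain ⟨r, hr, hsub⟩ := Metric.nhds_basis_closedBall.mem_iff.1
      (c.open_target.mem_nhds (c.map_source hz))
    set A := c.source ∩ c ⁻¹' Metric.ball (c z) r with hA
    have hAo : IsOpen A := c.isOpen_inter_preimage Metric.isOpen_ball
    refine ⟨A, hAo.mem_nhds ⟨hz, Metric.mem_ball_self hr⟩, ?_⟩
    rw [vol_apply_of_subset_source hAo.measurableSet inter_subset_left]
    have hsub2 : c.target ∩ c.symm ⁻¹' A ⊆ Metric.closedBall (c z) r := by
      rintro y ⟨hy, hyA⟩
      have := hyA.2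
      rw [mem_preimage, c.right_inv hy] at this
      exact Metric.ball_subset_closedBall this
    refine (lintegral_mono_set hsub2).trans_lt ?_
    have hint : IntegrableOn (fun y => sqrtDetMetric z y) (Metric.closedBall (c z) r) volume :=
      ((contDiffOn_sqrtDetMetric z).continuousOn.mono hsub).integrableOn_compact
        (isCompact_closedBall _ _)
    exact hint.lintegral_lt_top
  exact CompactSpace.isFiniteMeasure

instance isOpenPosMeasure_vol : (vol d M).IsOpenPosMeasure := by
  refine ⟨fun U hU ⟨z, hz⟩ h0 => ?_⟩
  set c := chartAt (EuclideanSpace ℝ (Fin d)) z with hc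
  have hzc : z ∈ c.source := mem_chart_source _ z
  have hUo : IsOpen (U ∩ c.source) := hU.inter c.open_source
  have h1 : vol d M (U ∩ c.source) = 0 := measure_mono_null inter_subset_left h0
  rw [vol_apply_of_subset_source (x₀ := z) hUo.measurableSet inter_subset_right] at h1
  have hopen : IsOpen (c.target ∩ c.symm ⁻¹' (U ∩ c.source)) :=
    c.continuousOn_symm.isOpen_inter_preimage c.open_target hUo
  have hne : (c.target ∩ c.symm ⁻¹' (U ∩ c.source)).Nonempty := by
    refine ⟨c z, c.map_source hzc, ?_⟩
    rw [mem_preimage, c.left_inv hzc]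
    exact ⟨hz, hzc⟩
  have hpos := hopen.measure_pos volume hne
  have hae : AEMeasurable (fun y => ENNReal.ofReal (sqrtDetMetric z y))
      (volume.restrict (c.target ∩ c.symm ⁻¹' (U ∩ c.source))) :=
    (((contDiffOn_sqrtDetMetric z).continuousOn.mono inter_subset_left).aemeasurable
      hopen.measurableSet).ennreal_ofReal
  rw [lintegral_eq_zero_iff' hae, EventuallyEq, ae_restrict_iff' hopen.measurableSet] at h1
  refine hpos.ne' (measure_mono_null (fun y hy => ?_) h1)
  simp only [mem_compl_iff, mem_ofPred_eq, not_forall]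
  refine ⟨hy, ?_⟩
  simpa using sqrtDetMetric_pos hy.1

end Volume

/-! ### Integration by parts on a Riemannian manifold -/

/-- A `C¹` function on an open set that vanishes off a compact subset extends by zero; the integrals
of its partial derivatives vanish. -/
theorem integral_fderiv_eq_zero_of_eqOn_diff {V : Type*} [NormedAddCommGroup V] [NormedSpace ℝ V]
    [FiniteDimensional ℝ V] [MeasurableSpace V] [BorelSpace V] {μ : Measure V}
    [μ.IsAddHaarMeasure] {T K : Set V} (hT : IsOpen T) (hK : IsCompact K) (hKT : K ⊆ T)
    {h : V → ℝ} (hh : ContDiffOn ℝ 1 h T) (h0 : ∀ y ∈ T, y ∉ K → h y = 0) (v : V) :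
    IntegrableOn (fun y => fderiv ℝ h y v) T μ ∧ ∫ y in T, fderiv ℝ h y v ∂μ = 0 := by
  classical
  set H : V → ℝ := T.indicator h with hH
  have hsupp : tsupport H ⊆ K := by
    refine closure_minimal (fun y hy => ?_) hK.isClosed
    by_contra hyK
    refine hy ?_
    by_cases hyT : y ∈ T
    · rw [hH, indicator_of_mem hyT, h0 y hyT hyK]
    · rw [hH, indicator_of_notMem hyT]
  have heq : ∀ y ∈ T, H =ᶠ[𝓝 y] h := fun y hy => by
    filter_upwards [hT.mem_nhds hy] with z hz
    rw [hH, indicator_of_mem hz]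
  have hcomp : HasCompactSupport H := hK.of_isClosed_subset (isClosed_tsupport _) hsupp
  have hdiff : ContDiff ℝ 1 H := by
    refine contMDiff_iff_contDiff.1 (contMDiff_of_tsupport fun y hy => ?_)
    have hyT := hKT (hsupp hy)
    exact contMDiffAt_iff_contDiffAt.2
      ((hh.contDiffAt (hT.mem_nhds hyT)).congr_of_eventuallyEq (heq y hyT))
  have hcont : Continuous fun y => fderiv ℝ H y v := hdiff.continuous_fderiv_apply one_ne_zero |>.comp
    (continuous_id.prodMk continuous_const)
  have hint : Integrable (fun y => fderiv ℝ H y v) μ :=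
    hcont.integrable_of_hasCompactSupport (hcomp.fderiv_apply ℝ v)
  -- Integration by parts against the constant function `1`.
  have hzero : ∫ y, fderiv ℝ H y v ∂μ = 0 := by
    have := integral_mul_fderiv_eq_neg_fderiv_mul_of_integrable (μ := μ) (f := fun _ : V => (1 : ℝ))
      (g := H) (v := v) (by simp) (by simpa using hint)
      (by simpa using hdiff.continuous.integrable_of_hasCompactSupport hcomp)
      (fun _ _ => differentiableAt_const _) (fun y _ => hdiff.differentiable one_ne_zero y)
    simpa using this
  have hcongr : EqOn (fun y => fderiv ℝ H y v) (fun y => fderiv ℝ h y v) T := fun y hy => by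
    simp only [(heq y hy).fderiv_eq]
  refine ⟨hint.integrableOn.congr_fun hcongr hT.measurableSet, ?_⟩
  rw [← setIntegral_congr_fun hT.measurableSet hcongr,
    setIntegral_eq_integral_of_forall_compl_eq_zero, hzero]
  intro y hy
  have : y ∉ tsupport (fderiv ℝ H) := fun hy' => hy (hKT (hsupp (tsupport_fderiv_subset ℝ hy')))
  rw [image_eq_zero_of_notMem_tsupport this]
  rfl

theorem continuous_of_continuousOn_of_tsupport {X Y : Type*} [TopologicalSpace X]
    [TopologicalSpace Y] [Zero Y] {f : X → Y} {U : Set X} (hU : IsOpen U) (hf : ContinuousOn f U)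
    (h : tsupport f ⊆ U) : Continuous f :=
  continuous_of_tsupport fun _ hx => hf.continuousAt (hU.mem_nhds (h hx))

/-! ### The divergence in charts and the divergence theorem. -/

section Divergence

variable {d : ℕ} {M : Type*} [TopologicalSpace M] [ChartedSpace (EuclideanSpace ℝ (Fin d)) M]

theorem contDiffOn_comp_chart_symm [IsManifold (𝓡 d) ∞ M] {k : WithTop ℕ∞}
    (hk : k ≤ (∞ : WithTop ℕ∞)) {φ : M → ℝ}
    (hφ : ContMDiff (𝓡 d) 𝓘(ℝ, ℝ) k φ) (x₀ : M) :
    ContDiffOn ℝ k (fun y => φ ((chartAt (EuclideanSpace ℝ (Fin d)) x₀).symm y))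
      (chartAt (EuclideanSpace ℝ (Fin d)) x₀).target := by
  have h := contMDiffOn_chart_symm (I := 𝓡 d) (n := ∞) (x := x₀)
  exact (hφ.comp_contMDiffOn (h.of_le hk)).contDiffOn

variable [RiemannianBundle (fun x : M => TangentSpace (𝓡 d) x)]

/-- The coordinate functions `√det g · Vⁱ` of a vector field in the chart at `x₀`. -/
def coordDensity (x₀ : M) (V : ∀ x : M, TangentSpace (𝓡 d) x) (i : Fin d)
    (y : EuclideanSpace ℝ (Fin d)) : ℝ :=
  sqrtDetMetric x₀ y * chartDeriv x₀ ((chartAt (EuclideanSpace ℝ (Fin d)) x₀).symm y)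
    (V ((chartAt (EuclideanSpace ℝ (Fin d)) x₀).symm y)) i

/-- The divergence of a vector field, computed in the chart at `x₀`. -/
def chartDivergence (x₀ : M) (V : ∀ x : M, TangentSpace (𝓡 d) x) (z : M) : ℝ :=
  (sqrtDetMetric x₀ (chartAt (EuclideanSpace ℝ (Fin d)) x₀ z))⁻¹ * ∑ i : Fin d,
    fderiv ℝ (coordDensity x₀ V i) (chartAt (EuclideanSpace ℝ (Fin d)) x₀ z)
      (EuclideanSpace.single i (1 : ℝ))

/-- The vector field `V` is of class `C¹`. -/
def IsC1Field (V : ∀ x : M, TangentSpace (𝓡 d) x) : Prop :=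
  ∀ (x : M) (i : Fin d),
    ContDiffOn ℝ 1 (coordDensity x V i) (chartAt (EuclideanSpace ℝ (Fin d)) x).target

theorem inner_grad_right (V : ∀ x : M, TangentSpace (𝓡 d) x) (φ : M → ℝ) (z : M) :
    inner ℝ (V z) (grad d φ z) = mfderiv (𝓡 d) 𝓘(ℝ, ℝ) φ z (V z) := by
  rw [real_inner_comm]
  exact InnerProductSpace.toDual_symm_apply

theorem grad_eq_zero_of_notMem_tsupport {φ : M → ℝ} {z : M} (hz : z ∉ tsupport φ) :
    grad d φ z = 0 := by
  have h : φ =ᶠ[𝓝 z] fun _ => 0 := notMem_tsupport_iff_eventuallyEq.1 hz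
  rw [grad, h.mfderiv_eq, mfderiv_const]
  exact map_zero _

variable [IsManifold (𝓡 d) ∞ M]

/-- The pairing is the differential of `φ` applied to `V`, so the chain rule through the inverse
chart suffices and the inverse metric does not appear. -/
theorem inner_grad_chart {V : ∀ x : M, TangentSpace (𝓡 d) x} {φ : M → ℝ}
    (hφ : ContMDiff (𝓡 d) 𝓘(ℝ, ℝ) 1 φ) {x₀ z : M}
    (hz : z ∈ (chartAt (EuclideanSpace ℝ (Fin d)) x₀).source) :
    inner ℝ (V z) (grad d φ z) = ∑ i : Fin d, chartDeriv x₀ z (V z) i *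
      fderiv ℝ (fun y => φ ((chartAt (EuclideanSpace ℝ (Fin d)) x₀).symm y))
        (chartAt (EuclideanSpace ℝ (Fin d)) x₀ z) (EuclideanSpace.single i (1 : ℝ)) := by
  set c := chartAt (EuclideanSpace ℝ (Fin d)) x₀ with hc
  have h1 := ((mdifferentiable_chart (I := 𝓡 d) x₀).mdifferentiableAt_symm
    (c.map_source hz)).hasMFDerivAt
  have h2 : HasMFDerivAt (𝓡 d) 𝓘(ℝ, ℝ) φ (c.symm (c z)) _ :=
    (hφ.mdifferentiableAt one_ne_zero).hasMFDerivAt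
  -- Typed on the fixed model space, the differential allows its base point `c.symm (c z)` to be
  -- rewritten to `z`.
  let L : M → EuclideanSpace ℝ (Fin d) →L[ℝ] ℝ := fun w => mfderiv (𝓡 d) 𝓘(ℝ, ℝ) φ w
  have h3 : HasFDerivAt (fun y => φ (c.symm y))
      ((L (c.symm (c z))).comp (chartSymmDeriv x₀ (c z))) (c z) := (h2.comp (c z) h1).hasFDerivAt
  rw [c.left_inv hz] at h3
  have h4 : ∀ u : EuclideanSpace ℝ (Fin d),
      fderiv ℝ (fun y => φ (c.symm y)) (c z) u = L z (chartSymmDeriv x₀ (c z) u) := by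
    intro u
    rw [h3.fderiv]
    rfl
  rw [inner_grad_right]
  have h5 := congrArg (L z) (chartSymmDeriv_chartDeriv hz (V z))
  refine (h5.symm.trans (h4 (chartDeriv x₀ z (V z))).symm).trans ?_
  set w := chartDeriv x₀ z (V z)
  have hw : w = ∑ i, w i • EuclideanSpace.single i (1 : ℝ) := by
    have := (EuclideanSpace.basisFun (Fin d) ℝ).toBasis.sum_repr w
    simpa using this.symm
  conv_lhs => rw [hw]
  simp

variable [IsContMDiffRiemannianBundle (𝓡 d) ∞ (EuclideanSpace ℝ (Fin d))
      (fun x : M => TangentSpace (𝓡 d) x)]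
  {V : ∀ x : M, TangentSpace (𝓡 d) x}

theorem continuousOn_chartDivergence (hV : IsC1Field V) (x₀ : M) :
    ContinuousOn (chartDivergence x₀ V) (chartAt (EuclideanSpace ℝ (Fin d)) x₀).source := by
  set c := chartAt (EuclideanSpace ℝ (Fin d)) x₀ with hc
  have hmaps : MapsTo c c.source c.target := fun z hz => c.map_source hz
  refine ContinuousOn.mul ?_ (continuousOn_finsetSum _ fun i _ => ?_)
  · exact (((contDiffOn_sqrtDetMetric x₀).continuousOn.comp c.continuousOn hmaps)).inv₀
      fun z hz => (sqrtDetMetric_pos (hmaps hz)).ne'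
  · have := (hV x₀ i).continuousOn_fderiv_of_isOpen c.open_target le_rfl
    exact (this.comp c.continuousOn hmaps).clm_apply continuousOn_const

theorem continuous_inner_grad (hV : IsC1Field V) {φ : M → ℝ}
    (hφ : ContMDiff (𝓡 d) 𝓘(ℝ, ℝ) 1 φ) :
    Continuous fun z => (inner ℝ (V z) (grad d φ z) : ℝ) := by
  rw [continuous_iff_continuousAt]
  intro x₀
  set c := chartAt (EuclideanSpace ℝ (Fin d)) x₀ with hc
  have hmaps : MapsTo c c.source c.target := fun z hz => c.map_source hz
  suffices h : ContinuousOn (fun z => (inner ℝ (V z) (grad d φ z) : ℝ)) c.source from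
    h.continuousAt (c.open_source.mem_nhds (mem_chart_source _ x₀))
  have : ∀ z ∈ c.source, (inner ℝ (V z) (grad d φ z) : ℝ) = ∑ i : Fin d,
      ((sqrtDetMetric x₀ (c z))⁻¹ * coordDensity x₀ V i (c z)) *
        fderiv ℝ (fun y => φ (c.symm y)) (c z) (EuclideanSpace.single i (1 : ℝ)) := by
    intro z hz
    rw [inner_grad_chart hφ hz]
    refine Finset.sum_congr rfl fun i _ => ?_
    rw [coordDensity, ← hc, c.left_inv hz,
      inv_mul_cancel_left₀ (sqrtDetMetric_pos (hmaps hz)).ne']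
  refine ContinuousOn.congr (continuousOn_finsetSum _ fun i _ => ?_) this
  refine ContinuousOn.mul (ContinuousOn.mul ?_ ?_) ?_
  · exact (((contDiffOn_sqrtDetMetric x₀).continuousOn.comp c.continuousOn hmaps)).inv₀
      fun z hz => (sqrtDetMetric_pos (hmaps hz)).ne'
  · exact (hV x₀ i).continuousOn.comp c.continuousOn hmaps
  · have := (contDiffOn_comp_chart_symm (by norm_cast) hφ x₀).continuousOn_fderiv_of_isOpen
      c.open_target le_rfl
    exact (this.comp c.continuousOn hmaps).clm_apply continuousOn_const

/-- A test function supported in the domain of a chart can be multiplied by the divergence computed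
in that chart. -/
theorem continuous_mul_chartDivergence (hV : IsC1Field V) {φ : M → ℝ} (hφ : Continuous φ) {x₀ : M}
    (hsupp : tsupport φ ⊆ (chartAt (EuclideanSpace ℝ (Fin d)) x₀).source) :
    Continuous fun z => φ z * chartDivergence x₀ V z :=
  continuous_of_continuousOn_of_tsupport (chartAt (EuclideanSpace ℝ (Fin d)) x₀).open_source
    (hφ.continuousOn.mul (continuousOn_chartDivergence hV x₀))
    ((tsupport_mul_subset_left).trans hsupp)

variable [MeasurableSpace M] [BorelSpace M] [CompactSpace M]

/-- By the product rule, `√det g` times the integrand is `∑ᵢ ∂ᵢ (√det g · Vⁱ ψ)` in coordinates.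
Each summand integrates to zero because `ψ` vanishes off the compact image of the support of `φ`. -/
theorem integral_inner_grad_add_mul_chartDivergence (hV : IsC1Field V) {φ : M → ℝ}
    (hφ : ContMDiff (𝓡 d) 𝓘(ℝ, ℝ) 1 φ) {x₀ : M}
    (hsupp : tsupport φ ⊆ (chartAt (EuclideanSpace ℝ (Fin d)) x₀).source) :
    ∫ z, (inner ℝ (V z) (grad d φ z) + φ z * chartDivergence x₀ V z) ∂(vol d M) = 0 := by
  set c := chartAt (EuclideanSpace ℝ (Fin d)) x₀ with hc
  have hcont : Continuous fun z => inner ℝ (V z) (grad d φ z) + φ z * chartDivergence x₀ V z :=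
    (continuous_inner_grad hV hφ).add (continuous_mul_chartDivergence hV hφ.continuous hsupp)
  rw [integral_vol_eq_integral_target (x₀ := x₀) hcont.measurable]
  swap
  · intro z hz
    have hz' : z ∉ tsupport φ := fun h => hz (hsupp h)
    rw [grad_eq_zero_of_notMem_tsupport hz', image_eq_zero_of_notMem_tsupport hz']
    simp
  set ψ : EuclideanSpace ℝ (Fin d) → ℝ := fun y => φ (c.symm y) with hψ
  have hψd : ContDiffOn ℝ 1 ψ c.target := contDiffOn_comp_chart_symm (by norm_cast) hφ x₀
  have hK : IsCompact (c '' tsupport φ) :=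
    ((isClosed_tsupport φ).isCompact).image_of_continuousOn (c.continuousOn.mono hsupp)
  have hKT : c '' tsupport φ ⊆ c.target := by
    rintro _ ⟨z, hz, rfl⟩
    exact c.map_source (hsupp hz)
  have h0 : ∀ y ∈ c.target, y ∉ c '' tsupport φ → ψ y = 0 := by
    intro y hy hyK
    exact image_eq_zero_of_notMem_tsupport (f := φ) fun h => hyK ⟨_, h, c.right_inv hy⟩
  have key := fun i : Fin d => integral_fderiv_eq_zero_of_eqOn_diff (μ := volume) c.open_target hK hKT
    ((hV x₀ i).mul hψd) (fun y hy hyK => by rw [h0 y hy hyK, mul_zero])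
    (EuclideanSpace.single i (1 : ℝ))
  calc ∫ y in c.target, sqrtDetMetric x₀ y * (inner ℝ (V (c.symm y)) (grad d φ (c.symm y))
        + φ (c.symm y) * chartDivergence x₀ V (c.symm y))
      = ∫ y in c.target, ∑ i : Fin d, fderiv ℝ (fun y => coordDensity x₀ V i y * ψ y) y
          (EuclideanSpace.single i (1 : ℝ)) := by
        refine setIntegral_congr_fun c.open_target.measurableSet fun y hy => ?_
        have hσ := (sqrtDetMetric_pos hy).ne'
        beta_reduce
        rw [inner_grad_chart hφ (c.map_target hy), chartDivergence, ← hc, c.right_inv hy, mul_add,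
          show ∀ a b e : ℝ, a * (b * (a⁻¹ * e)) = a * a⁻¹ * (b * e) by intros; ring,
          mul_inv_cancel₀ hσ, one_mul, Finset.mul_sum, Finset.mul_sum, ← Finset.sum_add_distrib]
        refine Finset.sum_congr rfl fun i _ => ?_
        rw [fderiv_fun_mul (((hV x₀ i).differentiableOn one_ne_zero).differentiableAt
            (c.open_target.mem_nhds hy))
          ((hψd.differentiableOn one_ne_zero).differentiableAt (c.open_target.mem_nhds hy))]
        simp only [add_apply, smul_apply, smul_eq_mul]
        rw [← mul_assoc]
        rfl
    _ = 0 := by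
        rw [integral_finsetSum _ fun i _ => (key i).1]
        exact Finset.sum_eq_zero fun i _ => (key i).2

theorem integrable_of_continuous {f : M → ℝ} (hf : Continuous f) : Integrable f (vol d M) :=
  hf.integrable_of_hasCompactSupport (HasCompactSupport.of_compactSpace f)

variable [T2Space M]

/-- The divergence does not depend on the chart. -/
theorem chartDivergence_eq (hV : IsC1Field V) (x₀ x₁ : M) :
    EqOn (chartDivergence x₀ V) (chartDivergence x₁ V)
      ((chartAt (EuclideanSpace ℝ (Fin d)) x₀).source ∩
        (chartAt (EuclideanSpace ℝ (Fin d)) x₁).source) := by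
  set U := (chartAt (EuclideanSpace ℝ (Fin d)) x₀).source ∩
        (chartAt (EuclideanSpace ℝ (Fin d)) x₁).source with hU
  have hUo : IsOpen U := (chartAt (EuclideanSpace ℝ (Fin d)) x₀).open_source.inter
    (chartAt (EuclideanSpace ℝ (Fin d)) x₁).open_source
  have hc0 : ContinuousOn (chartDivergence x₀ V) U :=
    (continuousOn_chartDivergence hV x₀).mono inter_subset_left
  have hc1 : ContinuousOn (chartDivergence x₁ V) U :=
    (continuousOn_chartDivergence hV x₁).mono inter_subset_right
  -- Against a test function supported in the overlap, both local divergences have the integral `-∫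
  -- ⟪V, ∇g⟫`. Hence they agree almost everywhere, and everywhere by continuity.
  have hae := hUo.ae_eq_zero_of_integral_contMDiff_smul_eq_zero (𝓡 d) (μ := vol d M)
    (f := fun z => chartDivergence x₀ V z - chartDivergence x₁ V z)
    ((hc0.sub hc1).locallyIntegrableOn hUo.measurableSet) fun g hg _ hgU => by
      have hg1 : ContMDiff (𝓡 d) 𝓘(ℝ, ℝ) 1 g := hg.of_le (by norm_cast)
      have s0 := hgU.trans inter_subset_left
      have s1 := hgU.trans inter_subset_right
      have i0 := integral_inner_grad_add_mul_chartDivergence hV hg1 s0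
      have i1 := integral_inner_grad_add_mul_chartDivergence hV hg1 s1
      have n := integrable_of_continuous (d := d) (continuous_inner_grad hV hg1)
      have n0 := integrable_of_continuous (d := d)
        (continuous_mul_chartDivergence hV hg1.continuous s0)
      have n1 := integrable_of_continuous (d := d)
        (continuous_mul_chartDivergence hV hg1.continuous s1)
      rw [integral_add n n0] at i0
      rw [integral_add n n1] at i1
      simp only [smul_eq_mul, mul_sub]
      rw [integral_sub n0 n1]
      linarith
  refine Measure.eqOn_open_of_ae_eq (μ := vol d M) ?_ hUo hc0 hc1
  rw [EventuallyEq, ae_restrict_iff' hUo.measurableSet]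
  filter_upwards [hae] with z hz hzU
  exact sub_eq_zero.1 (hz hzU)

theorem divergence_eqOn (hV : IsC1Field V) (x₀ : M) :
    EqOn (divergence V) (chartDivergence x₀ V)
      (chartAt (EuclideanSpace ℝ (Fin d)) x₀).source := fun z hz =>
  chartDivergence_eq hV z x₀ ⟨mem_chart_source _ z, hz⟩

theorem continuous_divergence (hV : IsC1Field V) : Continuous (divergence V) := by
  rw [continuous_iff_continuousAt]
  intro x₀
  have ho := (chartAt (EuclideanSpace ℝ (Fin d)) x₀).open_source
  exact ((continuousOn_chartDivergence hV x₀).congr (divergence_eqOn hV x₀)).continuousAt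
    (ho.mem_nhds (mem_chart_source _ x₀))

theorem integral_inner_grad_add_mul_divergence_of_tsupport (hV : IsC1Field V) {φ : M → ℝ}
    (hφ : ContMDiff (𝓡 d) 𝓘(ℝ, ℝ) 1 φ) {x₀ : M}
    (hsupp : tsupport φ ⊆ (chartAt (EuclideanSpace ℝ (Fin d)) x₀).source) :
    ∫ z, (inner ℝ (V z) (grad d φ z) + φ z * divergence V z) ∂(vol d M) = 0 := by
  rw [← integral_inner_grad_add_mul_chartDivergence hV hφ hsupp]
  refine integral_congr_ae (Eventually.of_forall fun z => ?_)
  by_cases hz : z ∈ tsupport φ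
  · simp only [divergence_eqOn hV x₀ (hsupp hz)]
  · simp only [image_eq_zero_of_notMem_tsupport hz, zero_mul]

/-- The divergence theorem. -/
theorem integral_inner_grad_eq_neg_integral_divergence (hV : IsC1Field V) {φ : M → ℝ}
    (hφ : ContMDiff (𝓡 d) 𝓘(ℝ, ℝ) 1 φ) :
    ∫ z, inner ℝ (V z) (grad d φ z) ∂(vol d M) = - ∫ z, divergence V z * φ z ∂(vol d M) := by
  -- Splitting `φ = ∑ᵢ fᵢ φ` puts each piece inside one chart; as the pieces sum to `φ`, so do their
  -- gradients.
  obtain ⟨f, hf⟩ := SmoothPartitionOfUnity.exists_isSubordinate (𝓡 d) (M := M) isClosed_univ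
    (fun x : chartCover d M => (chartAt (EuclideanSpace ℝ (Fin d)) (x : M)).source)
    (fun x => (chartAt (EuclideanSpace ℝ (Fin d)) (x : M)).open_source) fun z _ => by
      obtain ⟨x, hx, hz⟩ := (exists_chartCover d M).choose_spec z
      exact mem_iUnion.2 ⟨⟨x, hx⟩, hz⟩
  have hf1 : ∀ i, ContMDiff (𝓡 d) 𝓘(ℝ, ℝ) 1 fun z => f i z * φ z := fun i =>
    ((f i).contMDiff.of_le (by norm_cast)).mul hφ
  have hsum : ∀ z, ∑ i, f i z = 1 := fun z => by
    rw [← finsum_eq_sum_of_fintype]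
    exact f.sum_eq_one (mem_univ z)
  have hφsum : ∀ z, φ z = ∑ i, f i z * φ z := fun z => by
    rw [← Finset.sum_mul, hsum, one_mul]
  have hgrad : ∀ z, inner ℝ (V z) (grad d φ z)
      = ∑ i, inner ℝ (V z) (grad d (fun z => f i z * φ z) z) := by
    intro z
    have hz := mem_chart_source (EuclideanSpace ℝ (Fin d)) z
    simp only [inner_grad_chart hφ hz, inner_grad_chart (hf1 _) hz]
    rw [Finset.sum_comm]
    refine Finset.sum_congr rfl fun j _ => ?_
    rw [← Finset.mul_sum]
    congr 1
    set c := chartAt (EuclideanSpace ℝ (Fin d)) z with hc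
    have e : (fun y => φ (c.symm y)) = fun y => ∑ i, f i (c.symm y) * φ (c.symm y) :=
      funext fun y => hφsum _
    rw [e, fderiv_fun_sum fun i _ => ((contDiffOn_comp_chart_symm (by norm_cast) (hf1 i)
      z).differentiableOn one_ne_zero).differentiableAt (c.open_target.mem_nhds (c.map_source hz))]
    exact sum_apply _ _ _
  have hsub : ∀ i, tsupport (fun z => f i z * φ z)
      ⊆ (chartAt (EuclideanSpace ℝ (Fin d)) (i : M)).source := fun i =>
    (tsupport_mul_subset_left).trans (hf i)
  have hdiv := continuous_divergence hV
  have hzero : ∫ z, (inner ℝ (V z) (grad d φ z) + φ z * divergence V z) ∂(vol d M) = 0 := by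
    have e : ∀ z, inner ℝ (V z) (grad d φ z) + φ z * divergence V z
        = ∑ i, (inner ℝ (V z) (grad d (fun z => f i z * φ z) z)
          + (f i z * φ z) * divergence V z) := by
      intro z
      rw [Finset.sum_add_distrib, ← hgrad, ← Finset.sum_mul, ← hφsum]
    simp only [e]
    have hint : ∀ i, Integrable (fun z => inner ℝ (V z) (grad d (fun z => f i z * φ z) z)
        + (f i z * φ z) * divergence V z) (vol d M) := fun i => integrable_of_continuous
      ((continuous_inner_grad hV (hf1 i)).add ((hf1 i).continuous.mul hdiv))
    rw [integral_finsetSum _ fun i _ => hint i]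
    exact Finset.sum_eq_zero fun i _ =>
      integral_inner_grad_add_mul_divergence_of_tsupport hV (hf1 i) (hsub i)
  have hint : Integrable (fun z => φ z * divergence V z) (vol d M) :=
    integrable_of_continuous (hφ.continuous.mul hdiv)
  rw [integral_add (integrable_of_continuous (continuous_inner_grad hV hφ)) hint] at hzero
  simp only [mul_comm (divergence V _)]
  linarith

end Divergence

/-! ### Gradient fields and Wasserstein gradients -/

section GradientField

variable {d : ℕ} {M : Type*} [TopologicalSpace M] [ChartedSpace (EuclideanSpace ℝ (Fin d)) M]
  [RiemannianBundle (fun x : M => TangentSpace (𝓡 d) x)]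

theorem grad_sub {u v : M → ℝ} (hu : ContMDiff (𝓡 d) 𝓘(ℝ, ℝ) 2 u)
    (hv : ContMDiff (𝓡 d) 𝓘(ℝ, ℝ) 2 v) (x : M) :
    grad d (u - v) x = grad d u x - grad d v x := by
  rw [grad, mfderiv_sub (hu.mdifferentiableAt two_ne_zero) (hv.mdifferentiableAt two_ne_zero)]
  exact map_sub _ _ _

variable [IsManifold (𝓡 d) ∞ M]

/-- The coordinates of the gradient solve `∑ⱼ g_ij Gʲ = ∂ᵢ u`. -/
theorem metricMatrix_mulVec_grad {u : M → ℝ} (hu : ContMDiff (𝓡 d) 𝓘(ℝ, ℝ) 1 u) (x₀ : M)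
    {y : EuclideanSpace ℝ (Fin d)} (hy : y ∈ (chartAt (EuclideanSpace ℝ (Fin d)) x₀).target)
    (i : Fin d) :
    (metricMatrix x₀ y).mulVec (fun j => chartDeriv x₀
      ((chartAt (EuclideanSpace ℝ (Fin d)) x₀).symm y)
      (grad d u ((chartAt (EuclideanSpace ℝ (Fin d)) x₀).symm y)) j) i
    = fderiv ℝ (fun y => u ((chartAt (EuclideanSpace ℝ (Fin d)) x₀).symm y)) y
        (EuclideanSpace.single i (1 : ℝ)) := by
  set c := chartAt (EuclideanSpace ℝ (Fin d)) x₀ with hc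
  have hz := c.map_target hy
  have hcy : c (c.symm y) = y := c.right_inv hy
  set z := c.symm y with hzdef
  set b := chartSymmDeriv x₀ y (EuclideanSpace.single i (1 : ℝ)) with hb
  set w : EuclideanSpace ℝ (Fin d) := chartDeriv x₀ z (grad d u z) with hw
  -- The number `⟪∂ᵢ, ∇u⟫` is computed twice: as the `i`-th partial derivative of `u`, and by
  -- expanding `∇u` in the coordinate vectors. Only the value `b` at `z` of the field matters.
  have h1 := inner_grad_chart (V := fun _ => b) hu hz
  rw [← hc, hcy] at h1
  have h2 : chartDeriv x₀ z b = EuclideanSpace.single i (1 : ℝ) := by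
    have := chartDeriv_chartSymmDeriv hz (EuclideanSpace.single i (1 : ℝ))
    rwa [← hc, hcy] at this
  have h3 : ∑ j, chartDeriv x₀ z b j * fderiv ℝ (fun y => u (c.symm y)) y
      (EuclideanSpace.single j (1 : ℝ))
      = fderiv ℝ (fun y => u (c.symm y)) y (EuclideanSpace.single i (1 : ℝ)) := by
    rw [h2]
    simp
  have h4 : ∑ j, w j • chartSymmDeriv x₀ y (EuclideanSpace.single j (1 : ℝ)) = grad d u z := by
    have e : w = ∑ j, w j • EuclideanSpace.single j (1 : ℝ) := by
      have := (EuclideanSpace.basisFun (Fin d) ℝ).toBasis.sum_repr w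
      simpa using this.symm
    have h5 := chartSymmDeriv_chartDeriv hz (grad d u z)
    rw [← hc, hcy, ← hw, e] at h5
    simpa using h5
  have h6 := metricAt_sum_right Finset.univ z w
    (fun j => chartSymmDeriv x₀ y (EuclideanSpace.single j (1 : ℝ))) b
  rw [h4] at h6
  rw [← h3]
  refine Eq.trans ?_ h1
  refine Eq.trans ?_ h6.symm
  simp only [Matrix.mulVec, dotProduct, metricMatrix, Matrix.of_apply]
  exact Finset.sum_congr rfl fun j _ => mul_comm _ _

/-- The coordinates of `∇u` are `g⁻¹ ∂u`: a `C¹` inverse metric applied to first derivatives of a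
`C²` function. -/
theorem isC1Field_smul_grad [IsContMDiffRiemannianBundle (𝓡 d) ∞ (EuclideanSpace ℝ (Fin d))
      (fun x : M => TangentSpace (𝓡 d) x)] {p u : M → ℝ}
    (hp : ContMDiff (𝓡 d) 𝓘(ℝ, ℝ) 1 p) (hu : ContMDiff (𝓡 d) 𝓘(ℝ, ℝ) 2 u) :
    IsC1Field fun x => p x • grad d u x := by
  intro x₀ i
  set c := chartAt (EuclideanSpace ℝ (Fin d)) x₀ with hc
  have hu1 : ContMDiff (𝓡 d) 𝓘(ℝ, ℝ) 1 u := hu.of_le one_le_two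
  have hD : ∀ i : Fin d, ContDiffOn ℝ 1 (fun y => fderiv ℝ (fun y => u (c.symm y)) y
      (EuclideanSpace.single i (1 : ℝ))) c.target := fun i =>
    ((contDiffOn_comp_chart_symm (by norm_cast) hu x₀).fderiv_of_isOpen c.open_target
      (by norm_num)).clm_apply contDiffOn_const
  have hmain := ((contDiffOn_sqrtDetMetric x₀).mul
    ((contDiffOn_comp_chart_symm (by norm_cast) hp x₀).mul
      (contDiffOn_inv_mulVec (contDiffOn_metricMatrix x₀)
        (fun y hy => (metricMatrix_posDef hy).det_pos.ne') hD i)))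
  refine hmain.congr fun y hy => ?_
  have hw := funext (metricMatrix_mulVec_grad hu1 x₀ hy)
  have hunit : IsUnit (metricMatrix x₀ y).det :=
    isUnit_iff_ne_zero.2 (metricMatrix_posDef hy).det_pos.ne'
  rw [← hc] at hw
  rw [← hw, Matrix.mulVec_mulVec, Matrix.nonsing_inv_mul _ hunit, Matrix.one_mulVec, coordDensity]
  congr 1
  have := (chartDeriv x₀ (c.symm y)).map_smul (p (c.symm y)) (grad d u (c.symm y))
  exact congrArg (fun w : EuclideanSpace ℝ (Fin d) => w i) this


theorem continuous_inner_grad_mul [IsContMDiffRiemannianBundle (𝓡 d) ∞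
    (EuclideanSpace ℝ (Fin d)) (fun x : M => TangentSpace (𝓡 d) x)] {p u φ : M → ℝ}
    (hp : ContMDiff (𝓡 d) 𝓘(ℝ, ℝ) 1 p)
    (hu : ContMDiff (𝓡 d) 𝓘(ℝ, ℝ) 2 u) (hφ : ContMDiff (𝓡 d) 𝓘(ℝ, ℝ) 2 φ) :
    Continuous fun x => inner ℝ (grad d u x) (grad d φ x) * p x := by
  refine (continuous_inner_grad (isC1Field_smul_grad hp hu) (hφ.of_le one_le_two)).congr
    fun x => ?_
  rw [real_inner_smul_left, mul_comm]

end GradientField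

/-! ### Velocities and the uniqueness of the Wasserstein gradient. -/

section GradientUniqueness

variable {d : ℕ} {M : Type*} [MetricSpace M] [ChartedSpace (EuclideanSpace ℝ (Fin d)) M]
  [RiemannianBundle (fun x : M => TangentSpace (𝓡 d) x)] [CompactSpace M] [MeasurableSpace M]
  {F : P2 d M → ℝ} {p : P2 d M}

/-- Being `C²`, `g` may be inserted as the test function in `s = -div (p ∇u)`; symmetry of the
pairing gives the inner product. -/
theorem IsFunctionalDerivative.isWassersteinGradient {g : M → ℝ}
    (hg : ContMDiff (𝓡 d) 𝓘(ℝ, ℝ) 2 g) (hF : IsFunctionalDerivative F p g) :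
    IsWassersteinGradient F p (negDiv p g) := by
  let g' : C^2⟮𝓡 d, M; 𝓘(ℝ, ℝ), ℝ⟯ := ⟨g, hg⟩
  refine ⟨⟨g', rfl⟩, ?_⟩
  rintro S ⟨u, rfl⟩ γ s hγ hs
  have h := hF.2 γ s hγ
  have e : ∫ x, g x * s x ∂(vol d M) = wInner p (negDiv p g) (negDiv p u) := by
    have h1 := congrFun hs g'
    rw [negDiv_apply] at h1
    refine Eq.trans ?_ ((h1.trans ?_).trans (wInner_negDiv p g' u).symm)
    · simp only [ofFun, mul_comm (s _)]
      rfl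
    · simp only [real_inner_comm]
  rwa [e] at h

variable [BorelSpace M] [IsManifold (𝓡 d) ∞ M]
  [IsContMDiffRiemannianBundle (𝓡 d) ∞ (EuclideanSpace ℝ (Fin d))
      (fun x : M => TangentSpace (𝓡 d) x)]

theorem negDiv_eq_ofFun_divergence {u : M → ℝ} (hu : ContMDiff (𝓡 d) 𝓘(ℝ, ℝ) 2 u)
    (hp : ContMDiff (𝓡 d) 𝓘(ℝ, ℝ) 1 p.toFun) :
    negDiv p u = ofFun fun x => - divergence (fun y => p y • grad d u y) x := by
  funext φ
  have h := integral_inner_grad_eq_neg_integral_divergence (isC1Field_smul_grad hp hu)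
    (φ.contMDiff.of_le one_le_two)
  simp only [negDiv, weakDiv, ofFun, Pi.neg_apply, neg_neg, neg_mul, integral_neg]
  exact h

/-- The density `p + t s` as an element of `𝓟₂(M)`, for a bounded function `s` of mean zero. -/
def perturb (p : P2 d M) {s : M → ℝ} {C : ℝ} (hs : Measurable s) (hC : ∀ x, |s x| ≤ C)
    (h0 : ∫ x, s x ∂(vol d M) = 0) (t : ℝ) (ht : ∀ x, 0 ≤ p x + t * s x) : P2 d M where
  toFun x := p x + t * s x
  measurable := p.measurable.add (hs.const_mul t)
  nonneg := ht
  integrable := p.integrable.add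
    ((Integrable.of_bound hs.aestronglyMeasurable C (Eventually.of_forall hC)).const_mul t)
  integral_eq_one := by
    have hi := (Integrable.of_bound (μ := vol d M) hs.aestronglyMeasurable C
      (Eventually.of_forall hC)).const_mul t
    rw [integral_add p.integrable hi, integral_const_mul, h0, p.integral_eq_one]
    simp
  second_moment x₀ := by
    have hi := p.integrable.add ((Integrable.of_bound (μ := vol d M) hs.aestronglyMeasurable C
      (Eventually.of_forall hC)).const_mul t)
    -- On a compact space the squared distance is bounded, so integrability of the density suffices.
    have hd : Continuous fun x : M => dist x x₀ ^ 2 := by fun_prop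
    obtain ⟨D, hD⟩ := isCompact_univ.exists_bound_of_continuousOn hd.continuousOn
    exact hi.bdd_mul hd.aestronglyMeasurable (Eventually.of_forall fun x => hD x (mem_univ x))

/-- A bounded function of mean zero that keeps `p + t s` nonnegative for small `t` is a velocity. -/
theorem exists_hasVelocity (p : P2 d M) {s : M → ℝ} {C : ℝ} (hs : Measurable s)
    (hC : ∀ x, |s x| ≤ C) (h0 : ∫ x, s x ∂(vol d M) = 0) {t₀ : ℝ} (ht₀ : 0 < t₀)
    (hnonneg : ∀ t, 0 ≤ t → t ≤ t₀ → ∀ x, 0 ≤ p x + t * s x) :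
    ∃ γ : ℝ → P2 d M, HasVelocity γ p s := by
  classical
  -- The curve is `p + t s` as long as this is known to be nonnegative, and `p` otherwise; its
  -- difference quotient is exactly `s` for small `t > 0`.
  refine ⟨fun t => if h : 0 < t ∧ t ≤ t₀ then
    perturb p hs hC h0 t (hnonneg t h.1.le h.2) else p, by simp,
    MemLp.of_bound hs.aestronglyMeasurable C (Eventually.of_forall hC), ?_⟩
  refine tendsto_const_nhds.congr' ?_
  filter_upwards [Ioo_mem_nhdsGT ht₀] with t ht
  have e : (fun x => ((if h : 0 < t ∧ t ≤ t₀ then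
      perturb p hs hC h0 t (hnonneg t h.1.le h.2) else p) x - p x) / t - s x) = fun _ => 0 := by
    funext x
    rw [dif_pos ⟨ht.1, ht.2.le⟩]
    simp only [perturb]
    field_simp [ht.1.ne']
    ring
  rw [e]
  simp

theorem negDiv_sub (hp : ContMDiff (𝓡 d) 𝓘(ℝ, ℝ) 1 p.toFun)
    (u v φ : C^2⟮𝓡 d, M; 𝓘(ℝ, ℝ), ℝ⟯) :
    negDiv p (u - v) φ = negDiv p u φ - negDiv p v φ := by
  rw [negDiv_apply, negDiv_apply, negDiv_apply, ← integral_sub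
    (integrable_of_continuous (continuous_inner_grad_mul hp u.contMDiff φ.contMDiff))
    (integrable_of_continuous (continuous_inner_grad_mul hp v.contMDiff φ.contMDiff))]
  refine integral_congr_ae (Eventually.of_forall fun x => ?_)
  simp only [grad_sub u.contMDiff v.contMDiff, inner_sub_left, sub_mul]

/-- At a positive density of class `C¹`, a function of class `C²` is the potential of a velocity. -/
theorem exists_hasVelocity_of_pos (hp : ContMDiff (𝓡 d) 𝓘(ℝ, ℝ) 1 p.toFun)
    (hpos : ∀ x, 0 < p x) (u : C^2⟮𝓡 d, M; 𝓘(ℝ, ℝ), ℝ⟯) :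
    ∃ (γ : ℝ → P2 d M) (s : M → ℝ), HasVelocity γ p s ∧ ofFun s = negDiv p u := by
  set s : M → ℝ := fun x => - divergence (fun y => p y • grad d u y) x with hs
  have hS : negDiv p u = ofFun s := negDiv_eq_ofFun_divergence u.contMDiff hp
  have hcont : Continuous s :=
    (continuous_divergence (isC1Field_smul_grad hp u.contMDiff)).neg
  obtain ⟨C, hC⟩ := isCompact_univ.exists_bound_of_continuousOn hcont.continuousOn
  -- Test with the constant `1`, whose gradient vanishes.
  have h0 : ∫ x, s x ∂(vol d M) = 0 := by
    have h1 : ofFun s (1 : C^2⟮𝓡 d, M; 𝓘(ℝ, ℝ), ℝ⟯) = ∫ x, s x ∂(vol d M) := by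
      simp [ofFun]
    rw [← h1, ← hS, negDiv_apply]
    have : ∀ x, grad d (1 : C^2⟮𝓡 d, M; 𝓘(ℝ, ℝ), ℝ⟯) x = 0 := by
      intro x
      have : mfderiv (𝓡 d) 𝓘(ℝ, ℝ) (fun _ : M => (1 : ℝ)) x = 0 := mfderiv_const
      exact (congrArg _ this).trans (map_zero _)
    simp only [this, inner_zero_right, zero_mul, integral_zero]
  obtain ⟨c, hc, hcp⟩ : ∃ c : ℝ, 0 < c ∧ ∀ x, c ≤ p x := by
    rcases isEmpty_or_nonempty M with hM | hM
    · exact ⟨1, one_pos, fun x => (hM.false x).elim⟩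
    · obtain ⟨x, -, hx⟩ := isCompact_univ.exists_isMinOn univ_nonempty hp.continuous.continuousOn
      exact ⟨p x, hpos x, fun y => hx (mem_univ y)⟩
  -- The bound is enlarged to be positive, so that the time `c / (|C| + 1)` makes sense.
  have hC' : ∀ x, |s x| ≤ |C| + 1 := fun x =>
    ((hC x (mem_univ x)).trans (le_abs_self C)).trans (by linarith)
  have hCpos : 0 < |C| + 1 := by positivity
  obtain ⟨γ, hγ⟩ := exists_hasVelocity p hcont.measurable hC' h0 (div_pos hc hCpos)
    fun t ht ht' x => by
      have h1 : t * (|C| + 1) ≤ c := (le_div_iff₀ hCpos).1 ht'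
      have h2 : -(|C| + 1) ≤ s x := (abs_le.1 (hC' x)).1
      nlinarith [hcp x, mul_le_mul_of_nonneg_left h2 ht]
  exact ⟨γ, s, hγ, hS.symm⟩

/-- The difference `w` of the potentials is itself the potential of a velocity. Both gradients
compute the same one-sided derivative along it, so `∫ |∇w|² p = 0` and `∇w = 0` almost everywhere.
-/
theorem IsWassersteinGradient.unique (hp : ContMDiff (𝓡 d) 𝓘(ℝ, ℝ) 1 p.toFun)
    (hpos : ∀ x, 0 < p x) {G G' : Distrib d M} (hG : IsWassersteinGradient F p G)
    (hG' : IsWassersteinGradient F p G') : G = G' := by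
  obtain ⟨⟨v, rfl⟩, hv⟩ := hG
  obtain ⟨⟨g, rfl⟩, hg⟩ := hG'
  obtain ⟨γ, s, hγ, hs⟩ := exists_hasVelocity_of_pos hp hpos (v - g)
  have hmem : negDiv p (v - g : C^2⟮𝓡 d, M; 𝓘(ℝ, ℝ), ℝ⟯) ∈ tangentSet p := ⟨v - g, rfl⟩
  have h := (uniqueDiffWithinAt_Ici (0 : ℝ)).eq_deriv _ (hv _ hmem γ s hγ hs)
    (hg _ hmem γ s hγ hs)
  rw [wInner_negDiv, wInner_negDiv, ← negDiv_apply, ← negDiv_apply] at h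
  have h0 : negDiv p (v - g : C^2⟮𝓡 d, M; 𝓘(ℝ, ℝ), ℝ⟯) (v - g) = 0 := by
    have := negDiv_sub hp v g (v - g)
    rw [h, sub_self] at this
    exact this
  have hc := continuous_inner_grad_mul hp (v - g).contMDiff (v - g).contMDiff
  rw [negDiv_apply, integral_eq_zero_iff_of_nonneg
    (fun x => mul_nonneg real_inner_self_nonneg (hpos x).le) (integrable_of_continuous hc)] at h0
  funext φ
  refine sub_eq_zero.1 ((negDiv_sub hp v g φ).symm.trans ?_)
  have := negDiv_apply p (v - g : C^2⟮𝓡 d, M; 𝓘(ℝ, ℝ), ℝ⟯) φ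
  refine this.trans (integral_eq_zero_of_ae ?_)
  filter_upwards [h0] with x hx
  have hx' : grad d (v - g : C^2⟮𝓡 d, M; 𝓘(ℝ, ℝ), ℝ⟯) x = 0 :=
    inner_self_eq_zero.1 ((mul_eq_zero.1 hx).resolve_right (hpos x).ne')
  simp only [hx', inner_zero_left, zero_mul, Pi.zero_apply]

end GradientUniqueness

/-! ### Functionals in variational form -/

/-- A strongly convex function grows quadratically away from a minimizer. -/
theorem _root_.StrongConvexOn.add_sq_norm_le_of_forall_le {V : Type*} [NormedAddCommGroup V]
    [NormedSpace ℝ V] {s : Set V} {m : ℝ} {h : V → ℝ} (hh : StrongConvexOn s m h) {x : V}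
    (hx : x ∈ s) (hmin : ∀ y ∈ s, h x ≤ h y) {y : V} (hy : y ∈ s) :
    h x + m / 2 * ‖x - y‖ ^ 2 ≤ h y := by
  set K := m / 2 * ‖x - y‖ ^ 2 with hK
  have key : ∀ t : ℝ, 0 < t → t < 1 → (1 - t) * K ≤ h y - h x := by
    intro t ht ht1
    have h1 := hh.2 hx hy (by linarith : 0 ≤ 1 - t) ht.le (by ring)
    have h2 := hmin _ (hh.1 hx hy (by linarith : 0 ≤ 1 - t) ht.le (by ring))
    simp only [smul_eq_mul] at h1
    rw [← hK] at h1
    have h3 : t * ((1 - t) * K) ≤ t * (h y - h x) := by linarith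
    exact le_of_mul_le_mul_left h3 ht
  by_contra! hlt
  have h0 := hmin y hy
  have hKpos : 0 < K := by linarith
  -- This `t` makes `(1 - t) K` the midpoint of `h y - h x` and `K`, which exceeds `h y - h x` if
  -- the claim fails.
  have := key ((K - (h y - h x)) / (2 * K)) (div_pos (by linarith) (by linarith))
    ((div_lt_one (by linarith)).2 (by linarith))
  have e : (1 - (K - (h y - h x)) / (2 * K)) * K = (K + (h y - h x)) / 2 := by
    field_simp
    ring
  rw [e] at this
  linarith

section Variational

variable {X : Type*} [MeasurableSpace X] {μ : Measure X} {p : X → ℝ} {𝓕 : Set (Lp ℝ 2 μ)}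
  {Fstar : Lp ℝ 2 μ → ℝ} {lam : ℝ}

theorem integrable_Lp_two_mul (f : Lp ℝ 2 μ) {η : X → ℝ} (hη : MemLp η 2 μ) :
    Integrable (fun x => f x * η x) μ :=
  (Lp.memLp f).integrable_mul hη

theorem integral_Lp_two_mul_eq_inner (f : Lp ℝ 2 μ) {η : X → ℝ} (hη : MemLp η 2 μ) :
    ∫ x, f x * η x ∂μ = inner ℝ f (hη.toLp η) := by
  rw [L2.inner_def]
  refine integral_congr_ae ?_
  filter_upwards [hη.coeFn_toLp] with x hx
  rw [hx]
  exact mul_comm _ _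

theorem strongConvexOn_sub_integral_mul (hconv : StrongConvexOn 𝓕 lam Fstar)
    (hint : ∀ f ∈ 𝓕, Integrable (fun x => f x * p x) μ) :
    StrongConvexOn 𝓕 lam fun f => Fstar f - ∫ x, f x * p x ∂μ := by
  refine ⟨hconv.1, fun f hf g hg a b ha hb hab => ?_⟩
  have h := hconv.2 hf hg ha hb hab
  have e : ∫ x, (a • f + b • g : Lp ℝ 2 μ) x * p x ∂μ
      = a * ∫ x, f x * p x ∂μ + b * ∫ x, g x * p x ∂μ := by
    rw [← integral_const_mul, ← integral_const_mul,
      ← integral_add ((hint f hf).const_mul a) ((hint g hg).const_mul b)]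
    refine integral_congr_ae ?_
    filter_upwards [Lp.coeFn_add (a • f) (b • g), Lp.coeFn_smul a f, Lp.coeFn_smul b g]
      with x h1 h2 h3
    simp only [h1, h2, h3, Pi.add_apply, Pi.smul_apply, smul_eq_mul]
    ring
  simp only [smul_eq_mul] at h ⊢
  rw [e]
  linarith

theorem integral_mul_add_eq {f : Lp ℝ 2 μ} (hf : Integrable (fun x => f x * p x) μ) {η : X → ℝ}
    (hη : MemLp η 2 μ) : Integrable (fun x => f x * (p x + η x)) μ ∧
      ∫ x, f x * (p x + η x) ∂μ = (∫ x, f x * p x ∂μ) + ∫ x, f x * η x ∂μ := by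
  simp only [mul_add]
  exact ⟨hf.add (integrable_Lp_two_mul f hη), integral_add hf (integrable_Lp_two_mul f hη)⟩

/-- The value of the variational problem at `p + η` is at most its linearization at `p` plus a
quadratic error. -/
theorem integral_mul_add_sub_le (hlam : 0 < lam) (hconv : StrongConvexOn 𝓕 lam Fstar)
    (hint : ∀ f ∈ 𝓕, Integrable (fun x => f x * p x) μ) {fp : Lp ℝ 2 μ} (hfp : fp ∈ 𝓕)
    (hmax : ∀ f ∈ 𝓕, (∫ x, f x * p x ∂μ) - Fstar f ≤ (∫ x, fp x * p x ∂μ) - Fstar fp)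
    {η : X → ℝ} (hη : MemLp η 2 μ) {f : Lp ℝ 2 μ} (hf : f ∈ 𝓕) :
    (∫ x, f x * (p x + η x) ∂μ) - Fstar f ≤ (∫ x, fp x * p x ∂μ) - Fstar fp
      + ∫ x, fp x * η x ∂μ + (eLpNorm η 2 μ).toReal ^ 2 / (2 * lam) := by
  have h1 := (strongConvexOn_sub_integral_mul hconv hint).add_sq_norm_le_of_forall_le hfp
    (fun f hf => by linarith [hmax f hf]) hf
  rw [(integral_mul_add_eq (hint f hf) hη).2, integral_Lp_two_mul_eq_inner f hη,
    integral_Lp_two_mul_eq_inner fp hη]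
  set N := (eLpNorm η 2 μ).toReal with hN
  have hnorm : ‖hη.toLp η‖ = N := Lp.norm_toLp η hη
  have h2 : inner ℝ f (hη.toLp η) - inner ℝ fp (hη.toLp η) ≤ ‖fp - f‖ * N := by
    rw [← inner_sub_left, ← hnorm, norm_sub_rev]
    exact real_inner_le_norm _ _
  -- The right side is the maximum over `a` of `a N - (λ/2) a²`, attained at `a = N / λ`.
  have h3 : ‖fp - f‖ * N - lam / 2 * ‖fp - f‖ ^ 2 ≤ N ^ 2 / (2 * lam) := by
    rw [le_div_iff₀ (by positivity)]
    nlinarith [sq_nonneg (N - lam * ‖fp - f‖)]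
  linarith

/-- The supremum in the variational formula, at `p + η`, up to a quadratic error. -/
theorem abs_sub_le_of_isLUB (hlam : 0 < lam) (hconv : StrongConvexOn 𝓕 lam Fstar)
    (hint : ∀ f ∈ 𝓕, Integrable (fun x => f x * p x) μ) {fp : Lp ℝ 2 μ} (hfp : fp ∈ 𝓕)
    (hmax : ∀ f ∈ 𝓕, (∫ x, f x * p x ∂μ) - Fstar f ≤ (∫ x, fp x * p x ∂μ) - Fstar fp)
    {η : X → ℝ} (hη : MemLp η 2 μ) {L : ℝ}
    (hL : IsLUB ((fun f : Lp ℝ 2 μ => (∫ x, f x * (p x + η x) ∂μ) - Fstar f) '' 𝓕) L) :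
    |L - ((∫ x, fp x * p x ∂μ) - Fstar fp) - ∫ x, fp x * η x ∂μ|
      ≤ (eLpNorm η 2 μ).toReal ^ 2 / (2 * lam) := by
  have hup : L ≤ (∫ x, fp x * p x ∂μ) - Fstar fp
      + ∫ x, fp x * η x ∂μ + (eLpNorm η 2 μ).toReal ^ 2 / (2 * lam) := by
    refine hL.2 ?_
    rintro _ ⟨f, hf, rfl⟩
    exact integral_mul_add_sub_le hlam hconv hint hfp hmax hη hf
  -- The old maximizer is a competitor at `p + η`, so the linearization is a lower bound without
  -- error term.
  have hlow := hL.1 (mem_image_of_mem _ hfp)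
  beta_reduce at hlow
  rw [(integral_mul_add_eq (hint fp hfp) hη).2] at hlow
  have : 0 ≤ (eLpNorm η 2 μ).toReal ^ 2 / (2 * lam) := by positivity
  rw [abs_le]
  constructor <;> linarith

theorem exists_isLUB_hasDerivAt (hlam : 0 < lam) (hconv : StrongConvexOn 𝓕 lam Fstar)
    (hint : ∀ f ∈ 𝓕, Integrable (fun x => f x * p x) μ) {fp : Lp ℝ 2 μ} (hfp : fp ∈ 𝓕)
    (hmax : ∀ f ∈ 𝓕, (∫ x, f x * p x ∂μ) - Fstar f ≤ (∫ x, fp x * p x ∂μ) - Fstar fp)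
    {φ : X → ℝ} (hφ : MemLp φ 2 μ) : ∃ Φ : ℝ → ℝ,
      (∀ ε : ℝ, IsLUB ((fun f : Lp ℝ 2 μ =>
        (∫ x, f x * (p x + ε * φ x) ∂μ) - Fstar f) '' 𝓕) (Φ ε)) ∧
      HasDerivAt Φ (∫ x, fp x * φ x ∂μ) 0 := by
  have hLUB : ∀ ε : ℝ, ∃ L, IsLUB ((fun f : Lp ℝ 2 μ =>
      (∫ x, f x * (p x + ε * φ x) ∂μ) - Fstar f) '' 𝓕) L := fun ε =>
    Real.exists_isLUB ⟨_, mem_image_of_mem _ hfp⟩ ⟨_, by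
      rintro _ ⟨f, hf, rfl⟩
      exact integral_mul_add_sub_le hlam hconv hint hfp hmax (hφ.const_mul ε) hf⟩
  choose Φ hΦ using hLUB
  refine ⟨Φ, hΦ, ?_⟩
  set a := ∫ x, fp x * φ x ∂μ with ha
  set N := (eLpNorm φ 2 μ).toReal with hN
  have hnorm : ∀ ε : ℝ, (eLpNorm (fun x => ε * φ x) 2 μ).toReal = |ε| * N := fun ε => by
    have := eLpNorm_const_smul ε φ 2 μ
    rw [show (fun x => ε * φ x) = ε • φ from rfl, this, ENNReal.toReal_mul, hN]
    simp
  have hb : ∀ ε : ℝ, |Φ ε - ((∫ x, fp x * p x ∂μ) - Fstar fp) - ε * a|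
      ≤ ε ^ 2 * (N ^ 2 / (2 * lam)) := fun ε => by
    have h := abs_sub_le_of_isLUB hlam hconv hint hfp hmax (hφ.const_mul ε) (hΦ ε)
    have e : ∫ x, fp x * (ε * φ x) ∂μ = ε * a := by
      rw [ha, ← integral_const_mul]
      exact integral_congr_ae (Eventually.of_forall fun x => by ring)
    rw [hnorm, e, mul_pow, sq_abs, mul_div_assoc] at h
    exact h
  -- The quadratic bound itself, at `ε = 0`, identifies the value.
  have h0 : Φ 0 = (∫ x, fp x * p x ∂μ) - Fstar fp := by
    have := hb 0
    simp only [zero_mul, sub_zero, ne_eq, OfNat.ofNat_ne_zero, not_false_eq_true, zero_pow] at this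
    exact sub_eq_zero.1 (abs_eq_zero.1 (le_antisymm this (abs_nonneg _)))
  rw [hasDerivAt_iff_isLittleO_nhds_zero]
  refine Asymptotics.IsBigO.trans_isLittleO (g := fun ε : ℝ => ε ^ 2) ?_ ?_
  · refine Asymptotics.IsBigO.of_bound (N ^ 2 / (2 * lam)) (Eventually.of_forall fun ε => ?_)
    rw [zero_add, h0, smul_eq_mul, Real.norm_eq_abs, Real.norm_eq_abs, abs_of_nonneg (sq_nonneg ε)]
    linarith [hb ε]
  · exact Asymptotics.isLittleO_pow_id one_lt_two

end Variational

/-! ### Functional derivatives: existence from the variational form, uniqueness up to constants. -/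

section FunctionalDerivative

variable {d : ℕ} {M : Type*} [MetricSpace M] [ChartedSpace (EuclideanSpace ℝ (Fin d)) M]
  [RiemannianBundle (fun x : M => TangentSpace (𝓡 d) x)] [CompactSpace M] [MeasurableSpace M]
  {F : P2 d M → ℝ} {p : P2 d M}

theorem IsFunctionalDerivative.congr {g g' : M → ℝ} (hg : IsFunctionalDerivative F p g)
    (h : g' =ᵐ[vol d M] g) : IsFunctionalDerivative F p g' := by
  refine ⟨hg.1.ae_eq h.symm, fun γ s hγ => ?_⟩
  have e : ∫ x, g' x * s x ∂(vol d M) = ∫ x, g x * s x ∂(vol d M) :=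
    integral_congr_ae (h.mul EventuallyEq.rfl)
  rw [e]
  exact hg.2 γ s hγ

/-- With `r = (γ t - p) / t`, the quadratic estimate is applied to `η = t r`. Since `r → s` in `L²`,
the linear term divided by `t` tends to `∫ f_p s`, while the error, of order `t²`, disappears. -/
theorem isFunctionalDerivative_of_isLUB {𝓕 : Set (Lp ℝ 2 (vol d M))}
    {Fstar : Lp ℝ 2 (vol d M) → ℝ} {lam : ℝ} (hlam : 0 < lam)
    (hconv : StrongConvexOn 𝓕 lam Fstar)
    (hF : ∀ q : P2 d M, (∀ f ∈ 𝓕, Integrable (fun x => f x * q x) (vol d M)) →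
      IsLUB ((fun f : Lp ℝ 2 (vol d M) => (∫ x, f x * q x ∂(vol d M)) - Fstar f) '' 𝓕) (F q))
    (hint : ∀ f ∈ 𝓕, Integrable (fun x => f x * p x) (vol d M)) {fp : Lp ℝ 2 (vol d M)}
    (hfp : fp ∈ 𝓕) (hattained : F p = (∫ x, fp x * p x ∂(vol d M)) - Fstar fp)
    (hmax : ∀ f ∈ 𝓕, (∫ x, f x * p x ∂(vol d M)) - Fstar f
      ≤ (∫ x, fp x * p x ∂(vol d M)) - Fstar fp) :
    IsFunctionalDerivative F p fp := by
  refine ⟨Lp.memLp fp, fun γ s ⟨hγ0, hs, hγ⟩ => ?_⟩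
  rw [← hasDerivWithinAt_Ioi_iff_Ici, hasDerivWithinAt_iff_tendsto_slope' (by simp)]
  set e : ℝ → ℝ := fun t =>
    (eLpNorm (fun x => (γ t x - p x) / t - s x) 2 (vol d M)).toReal with he
  have he0 : Tendsto e (𝓝[>] 0) (𝓝 0) := (ENNReal.tendsto_toReal ENNReal.zero_ne_top).comp hγ
  set N := (eLpNorm s 2 (vol d M)).toReal with hN
  set a := ∫ x, fp x * s x ∂(vol d M) with ha
  rw [tendsto_iff_norm_sub_tendsto_zero]
  -- The first term bounds `∫ f_p (r - s)` by Cauchy–Schwarz; the second is the quadratic error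
  -- divided by `t`, with `‖r‖ ≤ e t + N`.
  have hlim : Tendsto (fun t : ℝ => ‖fp‖ * e t + t * ((e t + N) ^ 2 / (2 * lam))) (𝓝[>] 0)
      (𝓝 0) := by
    have ht : Tendsto (fun t : ℝ => t) (𝓝[>] 0) (𝓝 0) := tendsto_nhdsWithin_of_tendsto_nhds tendsto_id
    have := (he0.const_mul ‖fp‖).add (ht.mul (((he0.add_const N).pow 2).div_const (2 * lam)))
    simpa using this
  refine squeeze_zero' (Eventually.of_forall fun t => norm_nonneg _) ?_ hlim
  filter_upwards [self_mem_nhdsWithin, hγ.eventually_lt_const ENNReal.zero_lt_top] with t ht htop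
  have ht0 : (0 : ℝ) < t := ht
  set r : M → ℝ := fun x => (γ t x - p x) / t with hr
  have hrm : AEStronglyMeasurable r (vol d M) :=
    (((γ t).measurable.sub p.measurable).div_const t).aestronglyMeasurable
  have hδ : MemLp (fun x => r x - s x) 2 (vol d M) := ⟨hrm.sub hs.1, htop⟩
  have hrL : MemLp r 2 (vol d M) := by
    have := hδ.add hs
    refine this.ae_eq (Eventually.of_forall fun x => ?_)
    simp
  have hq : ∀ x, γ t x = p x + t * r x := fun x => by
    simp only [hr]
    field_simp
    ring
  have hη := hrL.const_mul t
  -- Since `γ t - p` is in `L²`, integrability against `p` passes to `γ t`, and the variational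
  -- formula is available there.
  have hL := hF (γ t) fun f hf => by
    simp only [hq]
    exact (integral_mul_add_eq (hint f hf) hη).1
  simp only [hq] at hL
  have hb := abs_sub_le_of_isLUB hlam hconv hint hfp hmax hη hL
  have e1 : ∫ x, fp x * (t * r x) ∂(vol d M)
      = t * (a + ∫ x, fp x * (r x - s x) ∂(vol d M)) := by
    rw [ha, ← integral_add (integrable_Lp_two_mul fp hs) (integrable_Lp_two_mul fp hδ),
      ← integral_const_mul]
    exact integral_congr_ae (Eventually.of_forall fun x => by ring)
  have e2 : (eLpNorm (fun x => t * r x) 2 (vol d M)).toReal ≤ t * (e t + N) := by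
    have h1 := eLpNorm_const_smul t r 2 (vol d M)
    have h2 : eLpNorm r 2 (vol d M)
        ≤ eLpNorm (fun x => r x - s x) 2 (vol d M) + eLpNorm s 2 (vol d M) := by
      have := eLpNorm_add_le hδ.1 hs.1 (p := 2) (by norm_num)
      refine le_trans (le_of_eq ?_) this
      congr 1
      funext x
      simp
    have h3 := ENNReal.toReal_mono (ENNReal.add_ne_top.2 ⟨htop.ne, hs.2.ne⟩) h2
    rw [ENNReal.toReal_add htop.ne hs.2.ne] at h3
    rw [show (fun x => t * r x) = t • r from rfl, h1, ENNReal.toReal_mul]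
    simp only [toReal_enorm, Real.norm_eq_abs, abs_of_pos ht0]
    exact mul_le_mul_of_nonneg_left h3 ht0.le
  have e3 : |∫ x, fp x * (r x - s x) ∂(vol d M)| ≤ ‖fp‖ * e t := by
    rw [integral_Lp_two_mul_eq_inner fp hδ]
    refine (abs_real_inner_le_norm _ _).trans (le_of_eq ?_)
    rw [Lp.norm_toLp]
  rw [e1, ← hattained] at hb
  have e4 : (eLpNorm (fun x => t * r x) 2 (vol d M)).toReal ^ 2 / (2 * lam)
      ≤ t * (t * ((e t + N) ^ 2 / (2 * lam))) := by
    have : t * (t * ((e t + N) ^ 2 / (2 * lam))) = (t * (e t + N)) ^ 2 / (2 * lam) := by ring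
    rw [this]
    gcongr
  have hslope : slope (fun t => F (γ t)) 0 t - a
      = t⁻¹ * (F (γ t) - F p - t * (a + ∫ x, fp x * (r x - s x) ∂(vol d M)))
        + ∫ x, fp x * (r x - s x) ∂(vol d M) := by
    rw [slope_def_field, hγ0, sub_zero]
    field_simp
    ring
  rw [hslope, add_comm]
  refine (norm_add_le _ _).trans (add_le_add e3 ?_)
  rw [norm_mul, norm_inv, Real.norm_eq_abs, Real.norm_eq_abs, abs_of_pos ht0, inv_mul_le_iff₀ ht0]
  exact hb.trans e4

variable [BorelSpace M] [IsManifold (𝓡 d) ∞ M]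
  [IsContMDiffRiemannianBundle (𝓡 d) ∞ (EuclideanSpace ℝ (Fin d))
      (fun x : M => TangentSpace (𝓡 d) x)]

/-- Otherwise `p` would vanish almost everywhere and could not have integral `1`. The set provides
mass that can be removed at a uniform rate. -/
theorem exists_pos_measure_le (p : P2 d M) :
    ∃ δ : ℝ, 0 < δ ∧ 0 < (vol d M).real {x | δ ≤ p x} := by
  by_contra! h
  have h0 : ∀ n : ℕ, vol d M {x | 1 / ((n : ℝ) + 1) ≤ p x} = 0 := fun n => by
    have := le_antisymm (h (1 / ((n : ℝ) + 1)) (by positivity)) measureReal_nonneg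
    exact (measureReal_eq_zero_iff (measure_ne_top _ _)).1 this
  have hae : ∀ᵐ x ∂(vol d M), p x = 0 := by
    have h1 : ∀ᵐ x ∂(vol d M), ∀ n : ℕ, p x < 1 / ((n : ℝ) + 1) := by
      rw [ae_all_iff]
      intro n
      simpa [ae_iff] using h0 n
    filter_upwards [h1] with x hx
    refine le_antisymm (le_of_forall_pos_lt_add fun ε hε => ?_) (p.nonneg x)
    obtain ⟨n, hn⟩ := exists_nat_one_div_lt hε
    linarith [hx n]
  have := p.integral_eq_one
  rw [integral_eq_zero_of_ae hae] at this
  exact zero_ne_one this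

/-- For measurable `A`, the function `|B| 1_A - |A| 1_B` has mean zero and is negative only on `B`,
where `p ≥ δ`; it is therefore a velocity. Comparing the two derivatives along it determines `∫_A
(g' - g)` as a fixed multiple of `|A|`. -/
theorem IsFunctionalDerivative.ae_eq_add_const {g g' : M → ℝ}
    (hg : IsFunctionalDerivative F p g) (hg' : IsFunctionalDerivative F p g') :
    ∃ c : ℝ, g' =ᵐ[vol d M] fun x => g x + c := by
  obtain ⟨δ, hδ, hb⟩ := exists_pos_measure_le p
  set B := {x | δ ≤ p x} with hB
  have hBm : MeasurableSet B := measurableSet_le measurable_const p.measurable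
  set b := (vol d M).real B with hbdef
  have hgi : Integrable g (vol d M) := hg.1.integrable one_le_two
  have hgi' : Integrable g' (vol d M) := hg'.1.integrable one_le_two
  have key : ∀ A, MeasurableSet A → b * ∫ x in A, g x ∂(vol d M)
      - (vol d M).real A * ∫ x in B, g x ∂(vol d M) = b * ∫ x in A, g' x ∂(vol d M)
      - (vol d M).real A * ∫ x in B, g' x ∂(vol d M) := by
    intro A hA
    set a := (vol d M).real A with ha
    have ha0 : 0 ≤ a := measureReal_nonneg
    set s : M → ℝ := fun x => b * A.indicator 1 x - a * B.indicator 1 x with hs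
    have hint : ∀ {k : M → ℝ}, Integrable k (vol d M) → ∫ x, k x * s x ∂(vol d M)
        = b * ∫ x in A, k x ∂(vol d M) - a * ∫ x in B, k x ∂(vol d M) := by
      intro k hk
      rw [← integral_indicator hA, ← integral_indicator hBm, ← integral_const_mul,
        ← integral_const_mul, ← integral_sub ((hk.indicator hA).const_mul b)
        ((hk.indicator hBm).const_mul a)]
      refine integral_congr_ae (Eventually.of_forall fun x => ?_)
      by_cases h1 : x ∈ A <;> by_cases h2 : x ∈ B <;> simp [hs, h1, h2] <;> ring
    have hsm : Measurable s := ((measurable_one.indicator hA).const_mul b).sub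
      ((measurable_one.indicator hBm).const_mul a)
    have hsb : ∀ x, |s x| ≤ b + a := fun x => by
      rw [abs_le]
      by_cases h1 : x ∈ A <;> by_cases h2 : x ∈ B <;> simp only [hs, h1, h2, indicator_of_mem,
        indicator_of_notMem, not_false_eq_true, Pi.one_apply] <;> constructor <;> linarith
    have hs0 : ∫ x, s x ∂(vol d M) = 0 := by
      have := hint (integrable_const (1 : ℝ))
      simp only [one_mul, integral_const, smul_eq_mul, mul_one, measureReal_restrict_apply_univ]
        at this
      rw [this]
      ring
    -- On `B` one has `s ≥ -a`; using `a + 1` keeps the time `δ / (a + 1)` defined when `A` is null.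
    obtain ⟨γ, hγ⟩ := exists_hasVelocity p hsm hsb hs0 (t₀ := δ / (a + 1)) (by positivity)
      fun t ht ht' x => by
        have h3 : t * (a + 1) ≤ δ := (le_div_iff₀ (by positivity)).1 ht'
        have h4 := p.nonneg x
        by_cases h2 : x ∈ B
        · have h5 : δ ≤ p x := h2
          have h6 : -(a + 1) ≤ s x := by
            by_cases h1 : x ∈ A <;> simp only [hs, h1, h2, indicator_of_mem,
              indicator_of_notMem, not_false_eq_true, Pi.one_apply] <;> linarith
          nlinarith [mul_le_mul_of_nonneg_left h6 ht]
        · have h6 : 0 ≤ s x := by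
            by_cases h1 : x ∈ A <;> simp only [hs, h1, h2, indicator_of_mem,
              indicator_of_notMem, not_false_eq_true, Pi.one_apply] <;> linarith
          positivity
    have := (uniqueDiffWithinAt_Ici (0 : ℝ)).eq_deriv _ (hg.2 γ s hγ) (hg'.2 γ s hγ)
    rwa [hint hgi, hint hgi'] at this
  -- The constant is the mean of `g' - g` over `B`, as read off from `key` after division by `b`.
  set c := (∫ x in B, g' x ∂(vol d M) - ∫ x in B, g x ∂(vol d M)) / b with hc
  refine ⟨c, Integrable.ae_eq_of_forall_setIntegral_eq _ _ hgi' (hgi.add (integrable_const c))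
    fun A hA _ => ?_⟩
  have h1 : ∫ x in A, (g x + c) ∂(vol d M)
      = ∫ x in A, g x ∂(vol d M) + (vol d M).real A * c := by
    rw [integral_add hgi.integrableOn (integrable_const c), setIntegral_const, smul_eq_mul]
  refine Eq.trans ?_ h1.symm
  have := key A hA
  have hb' : b ≠ 0 := hb.ne'
  rw [hc]
  field_simp
  linarith

end FunctionalDerivative

end WassersteinGradient

end

open WassersteinGradient in
theorem proposition3 {d : ℕ} {M : Type*} [MetricSpace M]
    [ChartedSpace (EuclideanSpace ℝ (Fin d)) M] [IsManifold (𝓡 d) ∞ M]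
    [RiemannianBundle (fun x : M => TangentSpace (𝓡 d) x)]
    [IsContMDiffRiemannianBundle (𝓡 d) ∞ (EuclideanSpace ℝ (Fin d))
      (fun x : M => TangentSpace (𝓡 d) x)]
    [IsRiemannianManifold (𝓡 d) M] [CompactSpace M] [MeasurableSpace M] [BorelSpace M]
    (F : P2 d M → ℝ) (p : P2 d M) :
    -- the gradient formula for a differentiable functional with functional derivative `g`
    (∀ g : M → ℝ, ContMDiff (𝓡 d) 𝓘(ℝ, ℝ) 2 g → IsFunctionalDerivative F p g →
      IsWassersteinGradient F p (negDiv p g) ∧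
      (ContMDiff (𝓡 d) 𝓘(ℝ, ℝ) 1 p.toFun →
        negDiv p g = ofFun (fun x => - divergence (fun y => p y • grad d g y) x) ∧
        ((∀ x, 0 < p x) → ∀ G, IsWassersteinGradient F p G → G = negDiv p g))) ∧
    -- functionals in variational form
    (∀ (𝓕 : Set (Lp ℝ 2 (vol d M))) (Fstar : Lp ℝ 2 (vol d M) → ℝ) (lam : ℝ), 0 < lam →
      StrongConvexOn 𝓕 lam Fstar →
      (∀ q : P2 d M, (∀ f ∈ 𝓕, Integrable (fun x => f x * q x) (vol d M)) →
        IsLUB ((fun f : Lp ℝ 2 (vol d M) => (∫ x, f x * q x ∂(vol d M)) - Fstar f) '' 𝓕) (F q)) →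
      (∀ f ∈ 𝓕, Integrable (fun x => f x * p x) (vol d M)) →
      ∀ fp ∈ 𝓕, F p = (∫ x, fp x * p x ∂(vol d M)) - Fstar fp →
        -- `fp` is the functional derivative, and the only one up to additive constants
        IsFunctionalDerivative F p fp ∧
        (∀ g : M → ℝ, IsFunctionalDerivative F p g →
          ∃ c : ℝ, g =ᵐ[vol d M] fun x => fp x + c) ∧
        -- `fp` is also the derivative of the variational expression in every `L²` direction
        (∀ φ : M → ℝ, MemLp φ 2 (vol d M) → ∃ Φ : ℝ → ℝ,
          (∀ ε : ℝ, IsLUB ((fun f : Lp ℝ 2 (vol d M) =>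
            (∫ x, f x * (p x + ε * φ x) ∂(vol d M)) - Fstar f) '' 𝓕) (Φ ε)) ∧
          HasDerivAt Φ (∫ x, fp x * φ x ∂(vol d M)) 0) ∧
        -- the gradient formula
        (∀ f₀ : M → ℝ, ContMDiff (𝓡 d) 𝓘(ℝ, ℝ) 2 f₀ → f₀ =ᵐ[vol d M] fp →
          IsWassersteinGradient F p (negDiv p f₀) ∧
          (ContMDiff (𝓡 d) 𝓘(ℝ, ℝ) 1 p.toFun →
            negDiv p f₀ = ofFun (fun x => - divergence (fun y => p y • grad d f₀ y) x) ∧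
            ((∀ x, 0 < p x) → ∀ G, IsWassersteinGradient F p G → G = negDiv p f₀)))) := by
  -- Serves both parts: in the second it is applied to `f₀`, a functional derivative because it
  -- agrees with `fp` almost everywhere.
  have smooth : ∀ g : M → ℝ, ContMDiff (𝓡 d) 𝓘(ℝ, ℝ) 2 g → IsFunctionalDerivative F p g →
      IsWassersteinGradient F p (negDiv p g) ∧
      (ContMDiff (𝓡 d) 𝓘(ℝ, ℝ) 1 p.toFun →
        negDiv p g = ofFun (fun x => - divergence (fun y => p y • grad d g y) x) ∧
        ((∀ x, 0 < p x) → ∀ G, IsWassersteinGradient F p G → G = negDiv p g)) :=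
    fun g hg hF => ⟨hF.isWassersteinGradient hg, fun hp => ⟨negDiv_eq_ofFun_divergence hg hp,
      fun hpos G hG => hG.unique hp hpos (hF.isWassersteinGradient hg)⟩⟩
  refine ⟨smooth, fun 𝓕 Fstar lam hlam hconv hF hint fp hfp hattained => ?_⟩
  have hmax : ∀ f ∈ 𝓕, (∫ x, f x * p x ∂(vol d M)) - Fstar f
      ≤ (∫ x, fp x * p x ∂(vol d M)) - Fstar fp := fun f hf =>
    hattained ▸ (hF p hint).1 (mem_image_of_mem _ hf)
  have hder := isFunctionalDerivative_of_isLUB hlam hconv hF hint hfp hattained hmax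
  exact ⟨hder, fun g hg => hder.ae_eq_add_const hg,
    fun φ hφ => exists_isLUB_hasDerivAt hlam hconv hint hfp hmax hφ,
    fun f₀ hf₀ hae => smooth f₀ hf₀ (hder.congr hae)⟩
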